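/- Let $n\ge 1$, $0<\alpha<n$ and $1<p\le q<\infty$, and let $p',q'$ be the conjugate exponents of $p,q$. Cubes in $\mathbb R^n$ have sides parallel to the axes. A weight is a non-negative, locally integrable function $\sigma$ on $\mathbb R^n$, and $\sigma(Q)=\int_Q\sigma\,dx$. Let $Mf(x)=\sup_{Q\ni x}|Q|^{-1}\int_Q|f|\,dy$, the supremum being over all cubes containing $x$, and $$\rho_\sigma(Q)=\frac1{\sigma(Q)}\int_Q M(\sigma\mathbf 1_Q)\,dx,\qquad I_\alpha f(x)=\int_{\mathbb R^n}\frac{f(y)}{|y-x|^{n-\alpha}}\,dy .$$ Let $c>0$, and let $\varepsilon_p,\varepsilon_{q'}$ be increasing functions on $[1,\infty)$, bounded below by $c$, with $$\int_1^\infty\frac{dt}{t\,\varepsilon_p(t)^p}=1,\qquad \int_1^\infty\frac{dt}{t\,\varepsilon_{q'}(t)^{q'}}=1 ;$$ put $\varepsilon_p(\infty)=\varepsilon_{q'}(\infty)=\infty$. For weights $\sigma,w$ let $$\lfloor\sigma,w\rfloor=\sup_{Q}\ \frac{\sigma(Q)^{1/p'}\,w(Q)^{1/q}}{|Q|^{1-\alpha/n}}\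 \rho_\sigma(Q)^{1/p}\,\varepsilon_p(\rho_\sigma(Q))\ \rho_w(Q)^{1/q'}\,\varepsilon_{q'}(\rho_w(Q)),$$ the supremum being over all cubes $Q$, where a cube with $\sigma(Q)=0$ or $w(Q)=0$ contributes $0$. If $\lfloor\sigma,w\rfloor<\infty$, then for every $f\in L^p(\sigma)$ the integral defining $I_\alpha(f\sigma)(x)$ converges absolutely for $w$-almost every $x$, $I_\alpha(f\sigma)\in L^q(w)$, and $$\|I_\alpha(f\sigma)\|_{L^q(w)}\le K\,C_{\alpha,n}\,\lfloor\sigma,w\rfloor\,\|f\|_{L^p(\sigma)},$$ where $C_{\alpha,n}$ depends only on $\alpha$ and $n$, and $K$ depends only on $p$, $q$ and $c$. -/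

import Mathlib

open MeasureTheory Set
open scoped ENNReal NNReal

noncomputable section

namespace EntropyBump

/-- The axis-parallel (half-open) cube with corner `a` and side length `l`. Faces are Lebesgue
null, so all quantities below are the same for open, closed and half-open cubes. -/
def cube {n : ℕ} (a : EuclideanSpace ℝ (Fin n)) (l : ℝ) : Set (EuclideanSpace ℝ (Fin n)) :=
  {x | ∀ i, a i ≤ x i ∧ x i < a i + l}

/-- A weight: a non-negative, locally integrable function. -/
structure IsWeight {n : ℕ} (σ : EuclideanSpace ℝ (Fin n) → ℝ) : Prop where
  nonneg : ∀ x, 0 ≤ σ x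
  locallyIntegrable : LocallyIntegrable σ volume

/-- The measure `σ dx`, so that `weightMeasure σ Q = ∫_Q σ dx`. -/
def weightMeasure {n : ℕ} (σ : EuclideanSpace ℝ (Fin n) → ℝ) :
    Measure (EuclideanSpace ℝ (Fin n)) :=
  volume.withDensity fun x => ENNReal.ofReal (σ x)

/-- The Hardy–Littlewood maximal function: the supremum of the averages of `|f|` over all cubes
containing `x`. -/
def maximalFunction {n : ℕ} (f : EuclideanSpace ℝ (Fin n) → ℝ)
    (x : EuclideanSpace ℝ (Fin n)) : ℝ≥0∞ :=
  ⨆ (a : EuclideanSpace ℝ (Fin n)) (l : ℝ) (_ : 0 < l) (_ : x ∈ cube a l),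
    (∫⁻ y in cube a l, ‖f y‖ₑ) / volume (cube a l)

/-- The local entropy `ρ_σ(Q) = σ(Q)⁻¹ ∫_Q M(σ 1_Q) dx`. -/
def rho {n : ℕ} (σ : EuclideanSpace ℝ (Fin n) → ℝ) (Q : Set (EuclideanSpace ℝ (Fin n))) : ℝ≥0∞ :=
  (∫⁻ x in Q, maximalFunction (Q.indicator σ) x) / weightMeasure σ Q

/-- An increasing function `ε` on `[1, ∞)` with `ε ≥ c` and `∫_1^∞ dt / (t ε(t)^s) = 1`
(the value `1` of the integral entails that the integrand is integrable). -/
structure IsEntropyFunction (s c : ℝ) (ε : ℝ → ℝ) : Prop where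
  monotoneOn : MonotoneOn ε (Ici 1)
  lower_bound : ∀ t, 1 ≤ t → c ≤ ε t
  integral_eq_one : ∫ t in Ioi (1 : ℝ), 1 / (t * ε t ^ s) = 1

/-- The value `ε(ρ)` for an extended number `ρ`, with `ε(∞) = ∞`, which is the limit of an entropy
function at infinity. -/
def evalAt (ε : ℝ → ℝ) (ρ : ℝ≥0∞) : ℝ≥0∞ :=
  if ρ = ∞ then ∞ else ENNReal.ofReal (ε ρ.toReal)

/-- `β(Q) = σ(Q)^{1/p'} w(Q)^{1/q} |Q|^{α/n-1} ρ_σ(Q)^{1/p} ε₁(ρ_σ(Q)) ρ_w(Q)^{1/q'} ε₂(ρ_w(Q))`.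
It vanishes as soon as `σ(Q) = 0` or `w(Q) = 0`; otherwise both entropies are at least one. -/
def beta {n : ℕ} (α p p' q q' : ℝ) (ε₁ ε₂ : ℝ → ℝ) (σ w : EuclideanSpace ℝ (Fin n) → ℝ)
    (Q : Set (EuclideanSpace ℝ (Fin n))) : ℝ≥0∞ :=
  weightMeasure σ Q ^ (1 / p') * weightMeasure w Q ^ (1 / q) * volume Q ^ (α / n - 1) *
    (rho σ Q ^ (1 / p) * evalAt ε₁ (rho σ Q)) * (rho w Q ^ (1 / q') * evalAt ε₂ (rho w Q))

/-- The bump constant `⌊σ, w⌋`: the supremum of `β(Q)` over all cubes. -/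
def bumpConstant {n : ℕ} (α p p' q q' : ℝ) (ε₁ ε₂ : ℝ → ℝ)
    (σ w : EuclideanSpace ℝ (Fin n) → ℝ) : ℝ≥0∞ :=
  ⨆ (a : EuclideanSpace ℝ (Fin n)) (l : ℝ) (_ : 0 < l), beta α p p' q q' ε₁ ε₂ σ w (cube a l)

/-- The integrand `y ↦ f(y) / |y - x|^{n-α}`. -/
def fracKernel {n : ℕ} (α : ℝ) (f : EuclideanSpace ℝ (Fin n) → ℂ)
    (x y : EuclideanSpace ℝ (Fin n)) : ℂ :=
  (‖y - x‖ ^ ((n : ℝ) - α))⁻¹ • f y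

/-- The fractional integral operator `I_α f(x) = ∫ f(y) / |y - x|^{n-α} dy`. -/
def fracIntegral {n : ℕ} (α : ℝ) (f : EuclideanSpace ℝ (Fin n) → ℂ)
    (x : EuclideanSpace ℝ (Fin n)) : ℂ :=
  ∫ y, fracKernel α f x y

end EntropyBump

end

open EntropyBump

/-! By positivity and duality it suffices to bound the double integral of φ(y)σ(y) g(x)w(x) / |y -
x|^{n-α} for φ, g ≥ 0. The one-third trick puts any two points (at distance at most L/3) into a cube
of comparable side from one of 2^n dyadic grids. Hence the truncated kernel is at most a constant
times the sum over the grids of Σ_Q |Q|^{α/n-1} 1_Q(x) 1_Q(y) (`fracWeight_le_sum`), and each grid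
yields a dyadic form Σ_Q |Q|^{α/n-1} (φσ)(Q) (gw)(Q).

Since |Q|^{α/n} decays geometrically with the level, this form is controlled by the cubes at which
the Lebesgue average of φσ reaches a new dyadic size (`exists_sparse_domination`). Split into two
families, these averages double at each step down, so every cube Q keeps a part E_Q with |Q| ≤
2|E_Q|, and the E_Q are disjoint. Therefore Σ_{Q ⊆ R} σ(Q) ≤ 2 ∫_R M(σ1_R) = 2 ρ_σ(R) σ(R): the
entropy is the local Carleson constant of a sparse family. Sorting cubes by ρ_σ ≈ 2^k and using Σ_k
ε_p(2^k)^{-p} < ∞ makes σ(Q) / (ρ_σ(Q) ε_p(ρ_σ(Q))^p) a Carleson sequence, and the embedding theorem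
`IsLaminar.tsum_mul_average_rpow_le` applies. The same family serves w, because its sparseness
refers to Lebesgue measure.

Finally the bump bounds each term by ⌊σ,w⌋ times a p-th root and a q'-th root of the two Carleson
summands (`volume_rpow_mul_le_of_beta_le`). Hölder's inequality, with ℓ^{q'} ⊆ ℓ^{p'} because p ≤ q,
finishes the estimate. -/

open EntropyBump

/-! ### Laminar families and the Carleson embedding theorem -/

section Laminar

variable {X I : Type*} [MeasurableSpace X]

/-- A family of measurable sets, graded by a level, in which sets of different index are either
disjoint or nested, the one of larger level being contained in the one of smaller level. -/
structure IsLaminar (Q : I → Set X) (lvl : I → ℕ) : Prop where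
  measurableSet : ∀ i, MeasurableSet (Q i)
  nested : ∀ i j, i ≠ j → lvl i ≤ lvl j → Disjoint (Q i) (Q j) ∨ (lvl i < lvl j ∧ Q j ⊆ Q i)

/-- The members of the family lying below a given one. -/
def belowSet (Q : I → Set X) (lvl : I → ℕ) (P : I) : Set I := {i | lvl P ≤ lvl i ∧ Q i ⊆ Q P}

/-- The maximal members of a subfamily. -/
def maxMembers (Q : I → Set X) (lvl : I → ℕ) (S : Set I) : Set I :=
  {i | i ∈ S ∧ ∀ j ∈ S, lvl j < lvl i → Disjoint (Q j) (Q i)}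

namespace IsLaminar

variable {Q : I → Set X} {lvl : I → ℕ}

theorem subset_of_lt (h : IsLaminar Q lvl) {i j : I} (hij : lvl i < lvl j)
    (hd : ¬ Disjoint (Q i) (Q j)) : Q j ⊆ Q i := by
  have hne : i ≠ j := by rintro rfl; exact lt_irrefl _ hij
  rcases h.nested i j hne hij.le with h1 | h1
  · exact absurd h1 hd
  · exact h1.2

/-- Levels are natural numbers, so climbing stops: a member that is not maximal meets one of smaller
level, which then contains it. -/
theorem exists_maxMember (h : IsLaminar Q lvl) (S : Set I) :
    ∀ i ∈ S, ∃ j ∈ maxMembers Q lvl S, i ∈ belowSet Q lvl j := by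
  suffices H : ∀ k : ℕ, ∀ i ∈ S, lvl i = k → ∃ j ∈ maxMembers Q lvl S, i ∈ belowSet Q lvl j from
    fun i hi => H _ i hi rfl
  intro k
  induction k using Nat.strong_induction_on with
  | _ k ih =>
    rintro i hi rfl
    by_cases hm : i ∈ maxMembers Q lvl S
    · exact ⟨i, hm, le_rfl, subset_rfl⟩
    · have hm' : ¬ ∀ j ∈ S, lvl j < lvl i → Disjoint (Q j) (Q i) := fun hc => hm ⟨hi, hc⟩
      push Not at hm'
      obtain ⟨j, hj, hlt, hd⟩ := hm'
      obtain ⟨m, hm, hml, hms⟩ := ih _ hlt j hj rfl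
      exact ⟨m, hm, hml.trans hlt.le, (h.subset_of_lt hlt hd).trans hms⟩

theorem pairwise_disjoint_maxMembers (h : IsLaminar Q lvl) (S : Set I) :
    Pairwise fun i j : maxMembers Q lvl S => Disjoint (Q i) (Q j) := by
  rintro ⟨i, hi⟩ ⟨j, hj⟩ hne
  have hne' : i ≠ j := fun e => hne (Subtype.ext e)
  rcases lt_trichotomy (lvl i) (lvl j) with hl | hl | hl
  · exact hj.2 i hi.1 hl
  · rcases h.nested i j hne' hl.le with h1 | h1
    · exact h1
    · exact absurd h1.1 (by omega)
  · exact (hi.2 j hj.1 hl).symm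

/-- The measures of the maximal members of a family of subsets of `T` add up to at most that
of `T`. -/
theorem tsum_maxMembers_le (h : IsLaminar Q lvl) (μ : Measure X) (S : Set I)
    {T : Set X} (hT : ∀ i ∈ S, Q i ⊆ T) :
    ∑' i : maxMembers Q lvl S, μ (Q i) ≤ μ T := by
  refine (tsum_meas_le_meas_iUnion_of_disjoint μ
    (As := fun i : maxMembers Q lvl S => Q i) (fun i => h.measurableSet i)
    (h.pairwise_disjoint_maxMembers S)).trans (measure_mono ?_)
  exact iUnion_subset fun i => hT i i.2.1

/-- A packing condition at the members of a family is a packing condition for the family. -/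
theorem tsum_le_of_packing (h : IsLaminar Q lvl) (μ : Measure X) (S : Set I)
    (a : I → ℝ≥0∞) (A : ℝ≥0∞)
    (ha : ∀ P ∈ S, ∑' i : ↥(S ∩ belowSet Q lvl P), a i ≤ A * μ (Q P)) :
    ∑' i : S, a i ≤ A * ∑' P : maxMembers Q lvl S, μ (Q P) := by
  have hsub : S ⊆ ⋃ P : maxMembers Q lvl S, (S ∩ belowSet Q lvl P) := by
    intro i hi
    obtain ⟨j, hj, hij⟩ := h.exists_maxMember S i hi
    exact mem_iUnion.2 ⟨⟨j, hj⟩, hi, hij⟩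
  calc ∑' i : S, a i ≤ ∑' i : ↥(⋃ P : maxMembers Q lvl S, (S ∩ belowSet Q lvl P)), a i :=
        ENNReal.tsum_mono_subtype a hsub
    _ ≤ ∑' P : maxMembers Q lvl S, ∑' i : ↥(S ∩ belowSet Q lvl P), a i :=
        ENNReal.tsum_iUnion_le_tsum a _
    _ ≤ ∑' P : maxMembers Q lvl S, A * μ (Q P) := ENNReal.tsum_le_tsum fun P => ha P P.2.1
    _ = _ := ENNReal.tsum_mul_left

/-- Weak type form of the Carleson embedding theorem. -/
theorem tsum_lt_average_le (h : IsLaminar Q lvl) (s : Measure X)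
    (hs : ∀ i, s (Q i) ≠ ∞) {φ : X → ℝ≥0} (hφ : Measurable φ)
    (a : I → ℝ≥0∞) (A : ℝ≥0∞)
    (ha : ∀ P, ∑' i : belowSet Q lvl P, a i ≤ A * s (Q P)) {t : ℝ} (ht : 0 < t) :
    ∑' i : {i | t < (s.withDensity (fun x => φ x) (Q i) / s (Q i)).toReal}, a i ≤
      A * (ENNReal.ofReal (2 / t) * s.withDensity (fun x => φ x) {x | t < (2 * φ x : ℝ)}) := by
  set S : Set I := {i | t < (s.withDensity (fun x => φ x) (Q i) / s (Q i)).toReal} with hS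
  have hU : MeasurableSet {x | t < (2 * φ x : ℝ)} :=
    measurableSet_lt measurable_const (by fun_prop)
  refine (h.tsum_le_of_packing s S a A fun P _ =>
    (ENNReal.tsum_mono_subtype a inter_subset_right).trans (ha P)).trans ?_
  gcongr
  -- The points of P with 2φ ≤ t carry at most (t/2) s(P) of a mass that is at least t s(P), so the
  -- points with 2φ > t carry the other half. Cancelling uses s(P) < ∞.
  have key : ∀ P ∈ S, s (Q P) ≤ ENNReal.ofReal (2 / t) *
      (s.withDensity (fun x => φ x)).restrict {x | t < (2 * φ x : ℝ)} (Q P) := by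
    intro P hP
    have hP1 : ENNReal.ofReal t * s (Q P) ≤ s.withDensity (fun x => φ x) (Q P) := by
      have h1 : ENNReal.ofReal t ≤ s.withDensity (fun x => φ x) (Q P) / s (Q P) :=
        ENNReal.ofReal_le_of_le_toReal (le_of_lt hP)
      exact ENNReal.mul_le_of_le_div h1
    rw [Measure.restrict_apply (h.measurableSet P)]
    have hsplit : s.withDensity (fun x => φ x) (Q P) ≤
        s.withDensity (fun x => φ x) (Q P ∩ {x | t < (2 * φ x : ℝ)}) +
          ENNReal.ofReal (t / 2) * s (Q P) := by
      rw [← measure_inter_add_sdiff (Q P) hU]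
      gcongr
      rw [withDensity_apply _ ((h.measurableSet P).diff hU)]
      calc ∫⁻ x in Q P \ {x | t < (2 * φ x : ℝ)}, φ x ∂s
          ≤ ∫⁻ x in Q P \ {x | t < (2 * φ x : ℝ)}, ENNReal.ofReal (t / 2) ∂s := by
            refine setLIntegral_mono' ((h.measurableSet P).diff hU) fun x hx => ?_
            have : (2 * φ x : ℝ) ≤ t := not_lt.1 hx.2
            rw [← ENNReal.ofReal_coe_nnreal]
            exact ENNReal.ofReal_le_ofReal (by linarith)
        _ = ENNReal.ofReal (t / 2) * s (Q P \ {x | t < (2 * φ x : ℝ)}) := by simp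
        _ ≤ _ := by gcongr; exact sdiff_subset
    have ht2 : ENNReal.ofReal t = ENNReal.ofReal (t / 2) + ENNReal.ofReal (t / 2) := by
      rw [← ENNReal.ofReal_add (by positivity) (by positivity)]; congr 1; ring
    have h3 : ENNReal.ofReal (t / 2) * s (Q P) ≤
        s.withDensity (fun x => φ x) (Q P ∩ {x | t < (2 * φ x : ℝ)}) := by
      have := hP1.trans hsplit
      rw [ht2, add_mul] at this
      exact (ENNReal.add_le_add_iff_right
        (ENNReal.mul_ne_top ENNReal.ofReal_ne_top (hs P))).1 this
    calc s (Q P) = ENNReal.ofReal (2 / t) * (ENNReal.ofReal (t / 2) * s (Q P)) := by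
          rw [← mul_assoc, ← ENNReal.ofReal_mul (by positivity)]
          rw [show 2 / t * (t / 2) = 1 by field_simp]; simp
      _ ≤ _ := by gcongr
  calc ∑' P : maxMembers Q lvl S, s (Q P)
      ≤ ∑' P : maxMembers Q lvl S, ENNReal.ofReal (2 / t) *
        (s.withDensity (fun x => φ x)).restrict {x | t < (2 * φ x : ℝ)} (Q P) :=
        ENNReal.tsum_le_tsum fun P => key P P.2.1
    _ = ENNReal.ofReal (2 / t) * ∑' P : maxMembers Q lvl S,
        (s.withDensity (fun x => φ x)).restrict {x | t < (2 * φ x : ℝ)} (Q P) :=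
        ENNReal.tsum_mul_left
    _ ≤ ENNReal.ofReal (2 / t) *
        (s.withDensity (fun x => φ x)).restrict {x | t < (2 * φ x : ℝ)} univ := by
        gcongr
        exact h.tsum_maxMembers_le _ S fun i _ => subset_univ _
    _ = _ := by rw [Measure.restrict_apply_univ]

/-- The constant in the Carleson embedding theorem. -/
noncomputable def _root_.carlesonConst (p : ℝ) : ℝ := p * 2 / (p - 1) * 2 ^ (p - 1)

/-- The Carleson embedding theorem. -/
theorem tsum_mul_average_rpow_le [Countable I] (h : IsLaminar Q lvl) (s : Measure X)
    (hs : ∀ i, s (Q i) ≠ ∞) {φ : X → ℝ≥0} (hφ : Measurable φ)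
    (hfin : ∀ i, s.withDensity (fun x => φ x) (Q i) ≠ ∞) {p : ℝ} (hp : 1 < p)
    (a : I → ℝ≥0∞) (A : ℝ≥0∞)
    (ha : ∀ P, ∑' i : belowSet Q lvl P, a i ≤ A * s (Q P)) :
    ∑' i, a i * (s.withDensity (fun x => φ x) (Q i) / s (Q i)) ^ p ≤
      ENNReal.ofReal (carlesonConst p) * A * ∫⁻ x, (φ x : ℝ≥0∞) ^ p ∂s := by
  let _ : MeasurableSpace I := ⊤
  have : MeasurableSingletonClass I := ⟨fun _ => MeasurableSpace.measurableSet_top⟩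
  set Φ := s.withDensity (fun x => (φ x : ℝ≥0∞)) with hΦ
  -- The sum becomes an integral over the index set with point masses `a i`, so that the layer-cake
  -- formula applies.
  set m : Measure I := Measure.count.withDensity a with hm
  have hma : Measurable a := measurable_from_top
  have hne : ∀ i, Φ (Q i) / s (Q i) ≠ ∞ := by
    intro i
    by_cases h0 : s (Q i) = 0
    · have : Φ (Q i) = 0 := withDensity_absolutelyContinuous s _ h0
      simp [this]
    · exact ENNReal.div_ne_top (hfin i) h0
  have hp0 : 0 < p := by linarith
  have lhs : ∑' i, a i * (Φ (Q i) / s (Q i)) ^ p =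
      ∫⁻ i, ENNReal.ofReal ((Φ (Q i) / s (Q i)).toReal ^ p) ∂m := by
    rw [hm, lintegral_withDensity_eq_lintegral_mul _ hma measurable_from_top, lintegral_count]
    refine tsum_congr fun i => ?_
    rw [Pi.mul_apply, ← ENNReal.ofReal_rpow_of_nonneg ENNReal.toReal_nonneg hp0.le,
      ENNReal.ofReal_toReal (hne i)]
  rw [lhs, lintegral_rpow_eq_lintegral_meas_lt_mul m
    (Filter.Eventually.of_forall fun i => ENNReal.toReal_nonneg)
    (measurable_from_top (f := fun i => (Φ (Q i) / s (Q i)).toReal)).aemeasurable hp0]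
  have hp1 : 0 < p - 1 := by linarith
  -- The weak type bound costs a factor 1/t, so on the side of φ the layer-cake formula is needed
  -- with exponent p - 1 > 0, against Φ = φ s; this restores φ^p.
  have rhs : ∫⁻ x, ENNReal.ofReal ((2 * φ x : ℝ) ^ (p - 1)) ∂Φ =
      ENNReal.ofReal (2 ^ (p - 1)) * ∫⁻ x, (φ x : ℝ≥0∞) ^ p ∂s := by
    rw [hΦ, lintegral_withDensity_eq_lintegral_mul _ (by fun_prop) (by fun_prop),
      ← lintegral_const_mul _ (by fun_prop)]
    refine lintegral_congr fun x => ?_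
    rw [Pi.mul_apply, Real.mul_rpow (by norm_num) (by positivity),
      ENNReal.ofReal_mul (by positivity),
      ← ENNReal.ofReal_rpow_of_nonneg (NNReal.coe_nonneg (φ x)) hp1.le, ENNReal.ofReal_coe_nnreal]
    rw [mul_left_comm]
    congr 1
    conv_lhs => rw [← ENNReal.rpow_one (φ x : ℝ≥0∞)]
    rw [← ENNReal.rpow_mul, ← ENNReal.rpow_add_of_nonneg _ _ (by norm_num) (by linarith)]
    congr 1; ring
  rw [lintegral_rpow_eq_lintegral_meas_lt_mul Φ (f := fun x => (2 * φ x : ℝ))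
    (Filter.Eventually.of_forall fun x => by positivity) (by fun_prop) hp1] at rhs
  have hint : ∫⁻ t in Ioi (0 : ℝ), Φ {x | t < (2 * φ x : ℝ)} * ENNReal.ofReal (t ^ (p - 1 - 1)) =
      ENNReal.ofReal (1 / (p - 1)) * (ENNReal.ofReal (2 ^ (p - 1)) *
        ∫⁻ x, (φ x : ℝ≥0∞) ^ p ∂s) := by
    rw [← rhs, ← mul_assoc, ← ENNReal.ofReal_mul (by positivity),
      show 1 / (p - 1) * (p - 1) = 1 by field_simp, ENNReal.ofReal_one, one_mul]
  calc ENNReal.ofReal p * ∫⁻ t in Ioi (0 : ℝ),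
        m {i | t < (Φ (Q i) / s (Q i)).toReal} * ENNReal.ofReal (t ^ (p - 1))
      ≤ ENNReal.ofReal p * ∫⁻ t in Ioi (0 : ℝ), A * ENNReal.ofReal 2 *
          (Φ {x | t < (2 * φ x : ℝ)} * ENNReal.ofReal (t ^ (p - 1 - 1))) := by
        gcongr ENNReal.ofReal p * ?_
        refine setLIntegral_mono' measurableSet_Ioi fun t ht => ?_
        have ht : 0 < t := ht
        have e : m {i | t < (Φ (Q i) / s (Q i)).toReal} =
            ∑' i : {i | t < (Φ (Q i) / s (Q i)).toReal}, a i := by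
          rw [hm, withDensity_apply _ MeasurableSpace.measurableSet_top, ← lintegral_indicator MeasurableSpace.measurableSet_top, lintegral_count,
            tsum_subtype]
        rw [e]
        calc _ ≤ A * (ENNReal.ofReal (2 / t) * Φ {x | t < (2 * φ x : ℝ)}) *
              ENNReal.ofReal (t ^ (p - 1)) := by
              gcongr
              exact h.tsum_lt_average_le s hs hφ a A ha ht
          _ = A * Φ {x | t < (2 * φ x : ℝ)} *
              ENNReal.ofReal (2 / t * t ^ (p - 1)) := by
              rw [ENNReal.ofReal_mul (by positivity)]; ring
          _ = A * Φ {x | t < (2 * φ x : ℝ)} *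
              (ENNReal.ofReal 2 * ENNReal.ofReal (t ^ (p - 1 - 1))) := by
              rw [← ENNReal.ofReal_mul (by positivity), Real.rpow_sub_one ht.ne' (p - 1)]
              congr 2; ring
          _ = _ := by ring
    _ ≤ ENNReal.ofReal p * (A * ENNReal.ofReal 2 * ∫⁻ t in Ioi (0 : ℝ),
          (Φ {x | t < (2 * φ x : ℝ)} * ENNReal.ofReal (t ^ (p - 1 - 1)))) := by
        gcongr
        refine (lintegral_const_mul _ ?_).le
        refine Measurable.mul ?_ (by fun_prop)
        refine Antitone.measurable fun t u htu => measure_mono fun x hx => ?_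
        exact lt_of_le_of_lt htu hx
    _ = _ := by
        rw [hint, carlesonConst, ENNReal.ofReal_mul (by positivity),
          show p * 2 / (p - 1) = p * 2 * (1 / (p - 1)) by ring,
          ENNReal.ofReal_mul (by positivity), ENNReal.ofReal_mul (by positivity)]
        ring

end IsLaminar

end Laminar

/-! ### Sparse subfamilies and sparse domination -/

section Sparse

variable {X I : Type*} [MeasurableSpace X]

/-- A subfamily along which the averages of `Φ` with respect to `μ` at least double from each
member to the members strictly below it. -/
structure IsDoubling (Q : I → Set X) (lvl : I → ℕ) (μ Φ : Measure X) (S : Set I) : Prop where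
  ne_zero : ∀ i ∈ S, Φ (Q i) ≠ 0
  doubling : ∀ i ∈ S, ∀ j ∈ S, lvl i < lvl j → ¬ Disjoint (Q i) (Q j) →
    2 * (Φ (Q i) / μ (Q i)) ≤ Φ (Q j) / μ (Q j)

/-- The part of a member of a subfamily that is not covered by members of larger level. -/
def exclusivePart (Q : I → Set X) (lvl : I → ℕ) (S : Set I) (i : I) : Set X :=
  Q i \ ⋃ j ∈ {j | j ∈ S ∧ lvl i < lvl j}, Q j

namespace IsLaminar

variable {Q : I → Set X} {lvl : I → ℕ}

theorem measurableSet_exclusivePart [Countable I] (h : IsLaminar Q lvl) (S : Set I) (i : I) :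
    MeasurableSet (exclusivePart Q lvl S i) :=
  (h.measurableSet i).diff
    (MeasurableSet.biUnion (Set.to_countable _) fun j _ => h.measurableSet j)

theorem disjoint_exclusivePart (h : IsLaminar Q lvl) (S : Set I) :
    Pairwise fun i j : S => Disjoint (exclusivePart Q lvl S i) (exclusivePart Q lvl S j) := by
  have aux : ∀ i j : I, j ∈ S → lvl i < lvl j →
      Disjoint (exclusivePart Q lvl S i) (exclusivePart Q lvl S j) := by
    intro i j hj hl
    refine Set.disjoint_left.2 fun x hx hx' => hx.2 ?_
    exact mem_biUnion (show j ∈ {j | j ∈ S ∧ lvl i < lvl j} from ⟨hj, hl⟩) hx'.1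
  rintro ⟨i, hi⟩ ⟨j, hj⟩ hne
  have hne' : i ≠ j := fun e => hne (Subtype.ext e)
  rcases lt_trichotomy (lvl i) (lvl j) with hl | hl | hl
  · exact aux i j hj hl
  · rcases h.nested i j hne' hl.le with h1 | h1
    · exact h1.mono sdiff_subset sdiff_subset
    · exact absurd h1.1 (by omega)
  · exact (aux j i hi hl).symm

/-- With v the average of Φ over Q_i, the maximal members below i have averages at least 2v and
total Φ-mass at most Φ(Q_i) = v μ(Q_i). So they cover at most half of Q_i. -/
theorem measure_le_two_mul_exclusivePart [Countable I] (h : IsLaminar Q lvl) {μ Φ : Measure X}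
    (hμ0 : ∀ i, μ (Q i) ≠ 0) (hμ : ∀ i, μ (Q i) ≠ ∞) (hΦ : ∀ i, Φ (Q i) ≠ ∞) {S : Set I}
    (hS : IsDoubling Q lvl μ Φ S) {i : I} (hi : i ∈ S) :
    μ (Q i) ≤ 2 * μ (exclusivePart Q lvl S i) := by
  set T : Set I := {j | j ∈ S ∧ lvl i < lvl j ∧ ¬ Disjoint (Q i) (Q j)} with hT
  set U : Set X := ⋃ j : maxMembers Q lvl T, Q j with hU
  have hsub : Q i ⊆ U ∪ exclusivePart Q lvl S i := by
    intro x hx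
    by_cases hxU : x ∈ U
    · exact Or.inl hxU
    · refine Or.inr ⟨hx, fun hx' => hxU ?_⟩
      obtain ⟨j, hj, hxj⟩ := mem_iUnion₂.1 hx'
      have hjT : j ∈ T := ⟨hj.1, hj.2, Set.not_disjoint_iff.2 ⟨x, hx, hxj⟩⟩
      obtain ⟨m, hm, hjm⟩ := h.exists_maxMember T j hjT
      exact mem_iUnion.2 ⟨⟨m, hm⟩, hjm.2 hxj⟩
  set v := Φ (Q i) / μ (Q i) with hv
  have hv0 : v ≠ 0 := ENNReal.div_ne_zero.2 ⟨hS.ne_zero i hi, hμ i⟩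
  have hvt : v ≠ ∞ := ENNReal.div_ne_top (hΦ i) (hμ0 i)
  have h1 : v * (2 * μ U) ≤ v * μ (Q i) := by
    calc v * (2 * μ U) ≤ v * (2 * ∑' j : maxMembers Q lvl T, μ (Q j)) := by
          gcongr; exact measure_iUnion_le _
      _ = ∑' j : maxMembers Q lvl T, 2 * v * μ (Q j) := by rw [ENNReal.tsum_mul_left]; ring
      _ ≤ ∑' j : maxMembers Q lvl T, Φ (Q j) := by
          refine ENNReal.tsum_le_tsum fun j => ?_
          have hj := j.2.1
          exact ENNReal.mul_le_of_le_div (hS.doubling i hi j hj.1 hj.2.1 hj.2.2)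
      _ ≤ Φ (Q i) := h.tsum_maxMembers_le Φ T fun j hj => h.subset_of_lt hj.2.1 hj.2.2
      _ = v * μ (Q i) := (ENNReal.div_mul_cancel (hμ0 i) (hμ i)).symm
  have h2 : 2 * μ U ≤ μ (Q i) := (ENNReal.mul_le_mul_iff_right hv0 hvt).1 h1
  have h3 : μ (Q i) + μ (Q i) ≤ μ (Q i) + 2 * μ (exclusivePart Q lvl S i) := by
    calc μ (Q i) + μ (Q i) = 2 * μ (Q i) := (two_mul _).symm
      _ ≤ 2 * (μ U + μ (exclusivePart Q lvl S i)) := by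
          gcongr; exact (measure_mono hsub).trans (measure_union_le _ _)
      _ = 2 * μ U + 2 * μ (exclusivePart Q lvl S i) := mul_add _ _ _
      _ ≤ _ := by gcongr
  exact (ENNReal.add_le_add_iff_left (hμ i)).1 h3

/-- Replace μ(Q) by twice the measure of its exclusive part, bound the average of s there by M, and
add over disjoint parts. With M the maximal function of σ1_R the right side is 2 ρ_σ(R) σ(R). -/
theorem tsum_measure_le_lintegral [Countable I] (h : IsLaminar Q lvl) {μ Φ : Measure X}
    (hμ0 : ∀ i, μ (Q i) ≠ 0) (hμ : ∀ i, μ (Q i) ≠ ∞) (hΦ : ∀ i, Φ (Q i) ≠ ∞) {S : Set I}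
    (hS : IsDoubling Q lvl μ Φ S) (s : Measure X) (R : I) (M : X → ℝ≥0∞)
    (hM : ∀ i ∈ belowSet Q lvl R, ∀ x ∈ Q i, s (Q i) / μ (Q i) ≤ M x) :
    ∑' i : ↥(S ∩ belowSet Q lvl R), s (Q i) ≤ 2 * ∫⁻ x in Q R, M x ∂μ := by
  set E := exclusivePart Q lvl S with hE
  have hdisj : Pairwise (Function.onFun Disjoint fun i : ↥(S ∩ belowSet Q lvl R) => E i) := by
    intro i j hne
    exact h.disjoint_exclusivePart S (i := ⟨i, i.2.1⟩) (j := ⟨j, j.2.1⟩)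
      (fun e => hne (Subtype.ext (Subtype.mk.inj e)))
  calc ∑' i : ↥(S ∩ belowSet Q lvl R), s (Q i)
      ≤ ∑' i : ↥(S ∩ belowSet Q lvl R), 2 * ∫⁻ x in E i, M x ∂μ := by
        refine ENNReal.tsum_le_tsum fun i => ?_
        calc s (Q i) = s (Q i) / μ (Q i) * μ (Q i) :=
              (ENNReal.div_mul_cancel (hμ0 i) (hμ i)).symm
          _ ≤ s (Q i) / μ (Q i) * (2 * μ (E i)) := by
              gcongr
              exact h.measure_le_two_mul_exclusivePart hμ0 hμ hΦ hS i.2.1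
          _ = 2 * ∫⁻ x in E i, s (Q i) / μ (Q i) ∂μ := by rw [setLIntegral_const]; ring
          _ ≤ 2 * ∫⁻ x in E i, M x ∂μ := by
              gcongr 2 * ?_
              exact setLIntegral_mono' (h.measurableSet_exclusivePart S i)
                fun x hx => hM i i.2.2 x hx.1
    _ = 2 * ∫⁻ x in ⋃ i : ↥(S ∩ belowSet Q lvl R), E i, M x ∂μ := by
        rw [ENNReal.tsum_mul_left,
          lintegral_iUnion (s := fun i : ↥(S ∩ belowSet Q lvl R) => E i)
            (fun i => h.measurableSet_exclusivePart S i) hdisj]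
    _ ≤ _ := by
        gcongr
        exact iUnion_subset fun i => sdiff_subset.trans i.2.2.2

/-- If the sums below `R` are bounded by `ρ R`, then division by `ρ` and a summable
function of `log ρ` produces a Carleson sequence. -/
theorem tsum_div_le_of_dyadic (h : IsLaminar Q lvl) (s : Measure X) (S : Set I)
    (ρ e : I → ℝ≥0∞) (η : ℕ → ℝ≥0∞) (r : I → ℕ)
    (hr : ∀ i ∈ S, 2 ^ r i ≤ ρ i ∧ ρ i ≤ 2 ^ (r i + 1) ∧ η (r i) ≤ e i)
    (hρ : ∀ R ∈ S, ∑' i : ↥(S ∩ belowSet Q lvl R), s (Q i) ≤ 2 * (ρ R * s (Q R))) (P : I) :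
    ∑' i : ↥(S ∩ belowSet Q lvl P), s (Q i) / (ρ i * e i) ≤
      4 * (∑' k, (η k)⁻¹) * s (Q P) := by
  set T : ℕ → Set I := fun k => {i | i ∈ S ∧ i ∈ belowSet Q lvl P ∧ r i = k} with hT
  have hsub : S ∩ belowSet Q lvl P ⊆ ⋃ k, T k := fun i hi => mem_iUnion.2 ⟨r i, hi.1, hi.2, rfl⟩
  -- Within one class ρ is constant up to a factor 2, so the sum of s(Q) is at most 2 · 2^(k+1)
  -- s(P), and division by ρ e ≥ 2^k η(k) removes the power of two.
  have hk : ∀ k, ∑' i : T k, s (Q i) / (ρ i * e i) ≤ 4 * (η k)⁻¹ * s (Q P) := by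
    intro k
    have h1 : ∑' i : T k, s (Q i) ≤ 4 * 2 ^ k * s (Q P) := by
      refine (h.tsum_le_of_packing s (T k) (fun i => s (Q i)) (4 * 2 ^ k) fun R hR => ?_).trans ?_
      · calc ∑' i : ↥(T k ∩ belowSet Q lvl R), s (Q i)
            ≤ ∑' i : ↥(S ∩ belowSet Q lvl R), s (Q i) :=
              ENNReal.tsum_mono_subtype (fun i => s (Q i)) fun i hi => ⟨hi.1.1, hi.2⟩
          _ ≤ 2 * (ρ R * s (Q R)) := hρ R hR.1
          _ ≤ 2 * (2 ^ (k + 1) * s (Q R)) := by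
              gcongr
              have := (hr R hR.1).2.1
              rwa [hR.2.2] at this
          _ = _ := by rw [pow_succ]; ring
      · gcongr
        exact h.tsum_maxMembers_le s (T k) fun i hi => hi.2.1.2
    have h20 : (2 : ℝ≥0∞) ^ k ≠ 0 := by positivity
    have h2t : (2 : ℝ≥0∞) ^ k ≠ ∞ := ENNReal.pow_ne_top (by simp)
    calc ∑' i : T k, s (Q i) / (ρ i * e i) ≤ ∑' i : T k, s (Q i) * (2 ^ k * η k)⁻¹ := by
          refine ENNReal.tsum_le_tsum fun i => ?_
          obtain ⟨h1, -, h2⟩ := hr i i.2.1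
          rw [i.2.2.2] at h1 h2
          rw [div_eq_mul_inv]
          gcongr
      _ = (∑' i : T k, s (Q i)) * (2 ^ k * η k)⁻¹ := ENNReal.tsum_mul_right
      _ ≤ 4 * 2 ^ k * s (Q P) * (2 ^ k * η k)⁻¹ := by gcongr
      _ = 4 * (η k)⁻¹ * s (Q P) * (2 ^ k * (2 ^ k)⁻¹) := by
          rw [ENNReal.mul_inv (Or.inl h20) (Or.inl h2t)]; ring
      _ = _ := by rw [ENNReal.mul_inv_cancel h20 h2t, mul_one]
  calc ∑' i : ↥(S ∩ belowSet Q lvl P), s (Q i) / (ρ i * e i)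
      ≤ ∑' i : ↥(⋃ k, T k), s (Q i) / (ρ i * e i) :=
        ENNReal.tsum_mono_subtype (fun i => s (Q i) / (ρ i * e i)) hsub
    _ ≤ ∑' k, ∑' i : T k, s (Q i) / (ρ i * e i) :=
        ENNReal.tsum_iUnion_le_tsum (fun i => s (Q i) / (ρ i * e i)) _
    _ ≤ ∑' k, 4 * (η k)⁻¹ * s (Q P) := ENNReal.tsum_le_tsum hk
    _ = _ := by rw [ENNReal.tsum_mul_right, ENNReal.tsum_mul_left]

/-- Members of one level inside R are disjoint, so each level contributes at most its coefficient
times ν(R). -/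
theorem tsum_belowSet_mul_le (h : IsLaminar Q lvl) (θ : ℕ → ℝ≥0∞) (C : ℝ≥0∞)
    (hθ : ∀ j, ∑' k, θ (j + k) ≤ C * θ j) (ν : Measure X) (R : I) :
    ∑' i : belowSet Q lvl R, θ (lvl i) * ν (Q i) ≤ C * θ (lvl R) * ν (Q R) := by
  set T : ℕ → Set I := fun k => {i | i ∈ belowSet Q lvl R ∧ lvl i = lvl R + k} with hT
  have hsub : belowSet Q lvl R ⊆ ⋃ k, T k := fun i hi =>
    mem_iUnion.2 ⟨lvl i - lvl R, hi, (Nat.add_sub_cancel' hi.1).symm⟩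
  calc ∑' i : belowSet Q lvl R, θ (lvl i) * ν (Q i)
      ≤ ∑' i : ↥(⋃ k, T k), θ (lvl i) * ν (Q i) :=
        ENNReal.tsum_mono_subtype (fun i => θ (lvl i) * ν (Q i)) hsub
    _ ≤ ∑' k, ∑' i : T k, θ (lvl i) * ν (Q i) :=
        ENNReal.tsum_iUnion_le_tsum (fun i => θ (lvl i) * ν (Q i)) _
    _ ≤ ∑' k, θ (lvl R + k) * ν (Q R) := by
        refine ENNReal.tsum_le_tsum fun k => ?_
        calc ∑' i : T k, θ (lvl i) * ν (Q i) = ∑' i : T k, θ (lvl R + k) * ν (Q i) :=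
              tsum_congr fun i => by rw [i.2.2]
          _ = θ (lvl R + k) * ∑' i : T k, ν (Q i) := ENNReal.tsum_mul_left
          _ ≤ _ := by
              gcongr
              refine (tsum_meas_le_meas_iUnion_of_disjoint ν (As := fun i : T k => Q i)
                (fun i => h.measurableSet i) ?_).trans
                (measure_mono (iUnion_subset fun i => i.2.1.2))
              intro i j hne
              rcases h.nested i j (fun e => hne (Subtype.ext e))
                (by rw [i.2.2, j.2.2]) with h1 | h1
              · exact h1
              · exact absurd h1.1 (by rw [i.2.2, j.2.2]; exact lt_irrefl _)
    _ = (∑' k, θ (lvl R + k)) * ν (Q R) := ENNReal.tsum_mul_right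
    _ ≤ _ := by gcongr; exact hθ _

/-- Sparse domination of a dyadic bilinear form whose coefficients decay with the level. -/
theorem exists_sparse_domination (h : IsLaminar Q lvl) {μ Φ : Measure X}
    (hμ0 : ∀ i, μ (Q i) ≠ 0) (hμ : ∀ i, μ (Q i) ≠ ∞) (hΦ : ∀ i, Φ (Q i) ≠ ∞)
    (θ : ℕ → ℝ≥0∞) (C : ℝ≥0∞) (hθ : ∀ j, ∑' k, θ (j + k) ≤ C * θ j) (ν : Measure X) :
    ∃ S₀ S₁ : Set I, IsDoubling Q lvl μ Φ S₀ ∧ IsDoubling Q lvl μ Φ S₁ ∧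
      ∑' i, θ (lvl i) * (Φ (Q i) / μ (Q i)) * ν (Q i) ≤
        2 * C * (∑' i : S₀, θ (lvl i) * (Φ (Q i) / μ (Q i)) * ν (Q i) +
          ∑' i : S₁, θ (lvl i) * (Φ (Q i) / μ (Q i)) * ν (Q i)) := by
  set v : I → ℝ≥0∞ := fun i => Φ (Q i) / μ (Q i) with hv
  have hvt : ∀ i, v i ≠ ∞ := fun i => ENNReal.div_ne_top (hΦ i) (hμ0 i)
  -- `k i` is the dyadic size of the average. It carries no information when Φ(Q_i) = 0, hence the
  -- non-vanishing conditions below.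
  set k : I → ℤ := fun i => Int.log 2 (v i).toReal with hk
  have hv0 : ∀ i, Φ (Q i) ≠ 0 → 0 < (v i).toReal := fun i hi =>
    ENNReal.toReal_pos (ENNReal.div_ne_zero.2 ⟨hi, hμ i⟩) (hvt i)
  have hlow : ∀ i, Φ (Q i) ≠ 0 → ((2 : ℕ) : ℝ) ^ k i ≤ (v i).toReal := fun i hi =>
    Int.zpow_log_le_self (by norm_num) (hv0 i hi)
  have hup : ∀ i, (v i).toReal < ((2 : ℕ) : ℝ) ^ (k i + 1) := fun i =>
    Int.lt_zpow_succ_log_self (by norm_num) _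
  have hdouble : ∀ i j, Φ (Q j) ≠ 0 → k i + 1 ≤ k j → v i ≤ v j := by
    intro i j hj hij
    refine (ENNReal.toReal_le_toReal (hvt i) (hvt j)).1 ?_
    exact (hup i).le.trans ((zpow_le_zpow_right₀ (by norm_num) hij).trans (hlow j hj))
  have htwo : ∀ i j, Φ (Q j) ≠ 0 → k i ≤ k j → v i ≤ 2 * v j := by
    intro i j hj hij
    refine (ENNReal.toReal_le_toReal (hvt i) (ENNReal.mul_ne_top (by simp) (hvt j))).1 ?_
    rw [ENNReal.toReal_mul]
    have h1 : ((2 : ℕ) : ℝ) ^ (k i + 1) ≤ ((2 : ℕ) : ℝ) ^ (k j + 1) :=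
      zpow_le_zpow_right₀ (by norm_num) (by omega)
    rw [zpow_add_one₀ (a := ((2 : ℕ) : ℝ)) (by norm_num) (k j)] at h1
    have h2 := hlow j hj
    have h3 := hup i
    norm_num at h1 h2 h3 ⊢
    linarith
  have htwo' : ∀ i j, Φ (Q j) ≠ 0 → k i + 2 ≤ k j → 2 * v i ≤ v j := by
    intro i j hj hij
    refine (ENNReal.toReal_le_toReal (ENNReal.mul_ne_top (by simp) (hvt i)) (hvt j)).1 ?_
    rw [ENNReal.toReal_mul]
    have h1 : ((2 : ℕ) : ℝ) ^ (k i + 1 + 1) ≤ ((2 : ℕ) : ℝ) ^ (k j) :=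
      zpow_le_zpow_right₀ (by norm_num) (by omega)
    rw [zpow_add_one₀ (a := ((2 : ℕ) : ℝ)) (by norm_num) (k i + 1)] at h1
    have h2 := hlow j hj
    have h3 := hup i
    norm_num at h1 h2 h3 ⊢
    linarith
  -- The members whose dyadic size exceeds that of every member above them. Descending in S, `k`
  -- grows strictly; within one parity class it grows by at least 2, which forces the averages to
  -- double.
  set S : Set I := {i | Φ (Q i) ≠ 0 ∧ ∀ j, lvl j < lvl i → ¬ Disjoint (Q j) (Q i) → k j < k i}
    with hS
  have hdoubling : ∀ b : ℤ, IsDoubling Q lvl μ Φ {i | i ∈ S ∧ k i % 2 = b} := by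
    refine fun b => ⟨fun i hi => hi.1.1, fun i hi j hj hl hd => htwo' i j hj.1.1 ?_⟩
    have h1 := hj.1.2 i hl hd
    have h2 := hi.2
    have h3 := hj.2
    omega
  refine ⟨_, _, hdoubling 0, hdoubling 1, ?_⟩
  set τ : I → ℝ≥0∞ := fun i => θ (lvl i) * v i * ν (Q i) with hτ
  set B : I → Set I := fun r => {i | i ∈ belowSet Q lvl r ∧ v i ≤ 2 * v r} with hB
  have hsub : Function.support τ ⊆ ⋃ r : S, B r := by
    intro i hi
    have hi0 : Φ (Q i) ≠ 0 := by
      intro h0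
      refine hi ?_
      simp [hτ, hv, h0]
    -- The maximal j above i of dyadic size at least `k i` lies in S: an ancestor of j at least as
    -- large would contradict maximality. So i is charged to j, and v i ≤ 2 v j.
    obtain ⟨j, hj, hij⟩ := h.exists_maxMember {j | Φ (Q j) ≠ 0 ∧ k i ≤ k j} i ⟨hi0, le_rfl⟩
    refine mem_iUnion.2 ⟨⟨j, hj.1.1, fun j' hl hd => ?_⟩, hij, htwo i j hj.1.1 hj.1.2⟩
    by_contra hc
    refine hd (hj.2 j' ⟨fun h0 => hj.1.1 ?_, hj.1.2.trans (not_lt.1 hc)⟩ hl)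
    exact measure_mono_null (h.subset_of_lt hl hd) h0
  have hr : ∀ r : S, ∑' i : B r, τ i ≤ 2 * C * τ r := by
    intro r
    calc ∑' i : B r, τ i ≤ ∑' i : B r, 2 * v r * (θ (lvl i) * ν (Q i)) := by
          refine ENNReal.tsum_le_tsum fun i => ?_
          calc τ i = v i * (θ (lvl i) * ν (Q i)) := by simp only [hτ]; ring
            _ ≤ _ := by gcongr; exact i.2.2
      _ = 2 * v r * ∑' i : B r, (θ (lvl i) * ν (Q i)) := ENNReal.tsum_mul_left
      _ ≤ 2 * v r * ∑' i : belowSet Q lvl r, (θ (lvl i) * ν (Q i)) := by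
          gcongr
          exact ENNReal.tsum_mono_subtype (fun i => θ (lvl i) * ν (Q i)) fun i hi => hi.1
      _ ≤ 2 * v r * (C * θ (lvl r) * ν (Q r)) := by
          gcongr
          exact h.tsum_belowSet_mul_le θ C hθ ν r
      _ = 2 * C * τ r := by simp only [hτ]; ring
  calc ∑' i, τ i = ∑' i : Function.support τ, τ i := (tsum_subtype_support τ).symm
    _ ≤ ∑' i : ↥(⋃ r : S, B r), τ i := ENNReal.tsum_mono_subtype τ hsub
    _ ≤ ∑' r : S, ∑' i : B r, τ i := ENNReal.tsum_iUnion_le_tsum τ _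
    _ ≤ ∑' r : S, 2 * C * τ r := ENNReal.tsum_le_tsum hr
    _ = 2 * C * ∑' r : S, τ r := ENNReal.tsum_mul_left
    _ ≤ _ := by
        gcongr
        refine (ENNReal.tsum_mono_subtype τ (t := {i | i ∈ S ∧ k i % 2 = 0} ∪
          {i | i ∈ S ∧ k i % 2 = 1}) fun i hi => ?_).trans (ENNReal.tsum_union_le τ _ _)
        rcases Int.emod_two_eq_zero_or_one (k i) with h0 | h1
        · exact Or.inl ⟨hi, h0⟩
        · exact Or.inr ⟨hi, h1⟩

end IsLaminar

end Sparse

/-- Hölder's inequality for sums, with an exponent that may be smaller than the conjugate one. -/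
theorem ENNReal.tsum_mul_le_of_le_conjExponent {I : Type*} {p p' r : ℝ}
    (hp : p.HolderConjugate p') (hr : 0 < r) (hrp : r ≤ p') (x y : I → ℝ≥0∞) :
    ∑' i, x i * y i ≤ (∑' i, x i ^ p) ^ (1 / p) * (∑' i, y i ^ r) ^ (1 / r) := by
  let _ : MeasurableSpace I := ⊤
  have : MeasurableSingletonClass I := ⟨fun _ => MeasurableSpace.measurableSet_top⟩
  have hp' : 0 < p' := hp.symm.pos
  set N := (∑' i, y i ^ r) ^ (1 / r) with hN
  have hNr : N ^ r = ∑' i, y i ^ r := by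
    rw [hN, ← ENNReal.rpow_mul, one_div_mul_cancel hr.ne', ENNReal.rpow_one]
  -- Each entry is at most the ℓ^r norm N, so y^{p'} ≤ N^{p'-r} y^r; this is the inclusion of ℓ^r in
  -- ℓ^{p'}.
  have hy : ∀ i, y i ≤ N := fun i => by
    have h1 : y i ^ r ≤ N ^ r := hNr ▸ ENNReal.le_tsum i
    exact (ENNReal.rpow_le_rpow_iff hr).1 h1
  have hsum : (∑' i, y i ^ p') ^ (1 / p') ≤ N := by
    have h1 : ∑' i, y i ^ p' ≤ N ^ p' := by
      calc ∑' i, y i ^ p' ≤ ∑' i, N ^ (p' - r) * y i ^ r := by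
            refine ENNReal.tsum_le_tsum fun i => ?_
            calc y i ^ p' = y i ^ (p' - r) * y i ^ r := by
                  rw [← ENNReal.rpow_add_of_nonneg _ _ (by linarith) hr.le]; congr 1; ring
              _ ≤ _ := by gcongr; exact hy i
        _ = N ^ (p' - r) * N ^ r := by rw [ENNReal.tsum_mul_left, hNr]
        _ = N ^ p' := by
            rw [← ENNReal.rpow_add_of_nonneg _ _ (by linarith) hr.le]; congr 1; ring
    calc (∑' i, y i ^ p') ^ (1 / p') ≤ (N ^ p') ^ (1 / p') := by gcongr
      _ = N := by rw [← ENNReal.rpow_mul, mul_one_div_cancel hp'.ne', ENNReal.rpow_one]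
  have hol := ENNReal.lintegral_mul_le_Lp_mul_Lq (Measure.count : Measure I) hp
    (f := x) (g := y) (measurable_from_top.aemeasurable) (measurable_from_top.aemeasurable)
  simp only [lintegral_count, Pi.mul_apply] at hol
  exact hol.trans (by gcongr)

/-! ### Entropy functions, cubes and dyadic grids -/

namespace EntropyBump

/-- The reciprocals of the values of an entropy function at the powers of two are summable. -/
theorem IsEntropyFunction.tsum_inv_le {s c : ℝ} (hs : 0 < s) (hc : 0 < c) {ε : ℝ → ℝ}
    (hε : IsEntropyFunction s c ε) :
    ∑' k : ℕ, (ENNReal.ofReal (ε (2 ^ k)) ^ s)⁻¹ ≤ ENNReal.ofReal (c ^ (-s)) + 2 := by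
  have hpos : ∀ t, 1 ≤ t → 0 < ε t := fun t ht => hc.trans_le (hε.lower_bound t ht)
  have hterm : ∀ t, 1 ≤ t → (ENNReal.ofReal (ε t) ^ s)⁻¹ = ENNReal.ofReal ((ε t ^ s)⁻¹) := by
    intro t ht
    rw [ENNReal.ofReal_rpow_of_pos (hpos t ht),
      ENNReal.ofReal_inv_of_pos (Real.rpow_pos_of_pos (hpos t ht) s)]
  -- A non-integrable function would have Bochner integral 0 rather than 1.
  have hint : IntegrableOn (fun t => 1 / (t * ε t ^ s)) (Ioi (1 : ℝ)) := by
    by_contra hc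
    have := hε.integral_eq_one
    rw [integral_undef hc] at this
    exact zero_ne_one this
  have hnn : ∀ᵐ t ∂volume.restrict (Ioi (1 : ℝ)), 0 ≤ 1 / (t * ε t ^ s) := by
    refine (ae_restrict_iff' measurableSet_Ioi).2 (Filter.Eventually.of_forall fun t ht => ?_)
    have ht : 1 < t := ht
    have := hpos t ht.le
    positivity
  have hone : ∫⁻ t in Ioi (1 : ℝ), ENNReal.ofReal (1 / (t * ε t ^ s)) = 1 := by
    rw [← ofReal_integral_eq_lintegral_ofReal hint hnn, hε.integral_eq_one, ENNReal.ofReal_one]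
  -- By monotonicity the integrand is at least its value with t = 2^(k+1), and the interval has half
  -- that length; hence the factor 2.
  have hpiece : ∀ k : ℕ, ENNReal.ofReal ((ε (2 ^ (k + 1)) ^ s)⁻¹) ≤
      2 * ∫⁻ t in Ioc ((2 : ℝ) ^ k) (2 ^ (k + 1)), ENNReal.ofReal (1 / (t * ε t ^ s)) := by
    intro k
    have h2k : (0 : ℝ) < 2 ^ k := by positivity
    have h1k : (1 : ℝ) ≤ 2 ^ k := one_le_pow₀ (by norm_num)
    have h1k' : (1 : ℝ) ≤ 2 ^ (k + 1) := one_le_pow₀ (by norm_num)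
    have hE : 0 < ε (2 ^ (k + 1)) ^ s := Real.rpow_pos_of_pos (hpos _ h1k') s
    calc ENNReal.ofReal ((ε (2 ^ (k + 1)) ^ s)⁻¹)
        = 2 * (ENNReal.ofReal (1 / (2 ^ (k + 1) * ε (2 ^ (k + 1)) ^ s)) *
            volume (Ioc ((2 : ℝ) ^ k) (2 ^ (k + 1)))) := by
          rw [Real.volume_Ioc, ← ENNReal.ofReal_mul (by positivity),
            show (2 : ℝ≥0∞) = ENNReal.ofReal 2 by simp, ← ENNReal.ofReal_mul (by norm_num)]
          congr 1
          rw [pow_succ]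
          field_simp
          ring
      _ = 2 * ∫⁻ t in Ioc ((2 : ℝ) ^ k) (2 ^ (k + 1)),
            ENNReal.ofReal (1 / (2 ^ (k + 1) * ε (2 ^ (k + 1)) ^ s)) := by
          rw [setLIntegral_const]
      _ ≤ _ := by
          gcongr 2 * ?_
          refine setLIntegral_mono' measurableSet_Ioc fun t ht => ENNReal.ofReal_le_ofReal ?_
          have ht1 : 1 ≤ t := h1k.trans ht.1.le
          have := hpos t ht1
          have h3 : ε t ≤ ε (2 ^ (k + 1)) := hε.monotoneOn ht1 h1k' ht.2
          gcongr
          exact ht.2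
  have hdisj : Pairwise (Function.onFun Disjoint
      fun k : ℕ => Ioc ((2 : ℝ) ^ k) (2 ^ (k + 1))) := by
    have hm : Monotone fun k : ℕ => (2 : ℝ) ^ k := fun a b hab =>
      pow_le_pow_right₀ (by norm_num) hab
    exact hm.pairwise_disjoint_on_Ioc_succ
  -- The term k = 0 has no interval to its left inside [1, ∞) and is bounded through ε ≥ c instead.
  rw [tsum_eq_zero_add' ENNReal.summable]
  gcongr
  · rw [pow_zero, hterm 1 le_rfl, Real.rpow_neg hc.le]
    have := hε.lower_bound 1 le_rfl
    gcongr
  · calc ∑' k : ℕ, (ENNReal.ofReal (ε (2 ^ (k + 1))) ^ s)⁻¹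
        ≤ ∑' k : ℕ, 2 * ∫⁻ t in Ioc ((2 : ℝ) ^ k) (2 ^ (k + 1)),
            ENNReal.ofReal (1 / (t * ε t ^ s)) := by
          refine ENNReal.tsum_le_tsum fun k => ?_
          rw [hterm _ (one_le_pow₀ (by norm_num))]
          exact hpiece k
      _ = 2 * ∫⁻ t in ⋃ k : ℕ, Ioc ((2 : ℝ) ^ k) (2 ^ (k + 1)),
            ENNReal.ofReal (1 / (t * ε t ^ s)) := by
          rw [ENNReal.tsum_mul_left, lintegral_iUnion (fun k => measurableSet_Ioc) hdisj]
      _ ≤ 2 * ∫⁻ t in Ioi (1 : ℝ), ENNReal.ofReal (1 / (t * ε t ^ s)) := by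
          gcongr
          refine iUnion_subset fun k t ht => ?_
          exact lt_of_le_of_lt (one_le_pow₀ (by norm_num)) ht.1
      _ = 2 := by rw [hone, mul_one]

variable {n : ℕ}

theorem cube_eq_preimage (a : EuclideanSpace ℝ (Fin n)) (l : ℝ) :
    cube a l = (MeasurableEquiv.toLp 2 (Fin n → ℝ)).symm ⁻¹'
      (univ.pi fun i => Ico (a i) (a i + l)) := by
  ext x
  simp [cube]

theorem measurableSet_cube (a : EuclideanSpace ℝ (Fin n)) (l : ℝ) : MeasurableSet (cube a l) := by
  rw [cube_eq_preimage]
  exact (MeasurableEquiv.measurable _) (MeasurableSet.univ_pi fun i => measurableSet_Ico)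

theorem volume_cube (a : EuclideanSpace ℝ (Fin n)) (l : ℝ) :
    volume (cube a l) = ENNReal.ofReal l ^ n := by
  rw [cube_eq_preimage, (EuclideanSpace.volume_preserving_symm_measurableEquiv_toLp
    (Fin n)).measure_preimage_equiv, volume_pi_pi]
  simp

theorem volume_cube_ne_zero (a : EuclideanSpace ℝ (Fin n)) {l : ℝ} (hl : 0 < l) :
    volume (cube a l) ≠ 0 := by
  rw [volume_cube]
  exact pow_ne_zero _ (by simpa using hl)

theorem volume_cube_ne_top (a : EuclideanSpace ℝ (Fin n)) (l : ℝ) :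
    volume (cube a l) ≠ ∞ := by
  rw [volume_cube]
  exact ENNReal.pow_ne_top ENNReal.ofReal_ne_top

theorem isBounded_cube (a : EuclideanSpace ℝ (Fin n)) (l : ℝ) :
    Bornology.IsBounded (cube a l) := by
  have h : Bornology.IsBounded (univ.pi fun i => Ico (a i) (a i + l)) :=
    Bornology.IsBounded.pi fun i => Metric.isBounded_Ico _ _
  have h2 := (PiLp.lipschitzWith_toLp 2 (fun _ : Fin n => ℝ)).isBounded_image h
  refine h2.subset fun x hx => ⟨x.ofLp, fun i _ => hx i, rfl⟩

theorem IsWeight.weightMeasure_lt_top {σ : EuclideanSpace ℝ (Fin n) → ℝ} (hσ : IsWeight σ)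
    {T : Set (EuclideanSpace ℝ (Fin n))} (hT : MeasurableSet T) (hb : Bornology.IsBounded T) :
    weightMeasure σ T < ∞ := by
  rw [weightMeasure, withDensity_apply _ hT]
  have h1 : IntegrableOn σ (closure T) :=
    hσ.locallyIntegrable.integrableOn_isCompact hb.isCompact_closure
  have h2 : IntegrableOn σ T := h1.mono_set subset_closure
  refine lt_of_le_of_lt (lintegral_mono fun x => ?_) h2.2
  rw [← ofReal_norm]
  exact ENNReal.ofReal_le_ofReal (le_abs_self _)

theorem IsWeight.weightMeasure_cube_ne_top {σ : EuclideanSpace ℝ (Fin n) → ℝ} (hσ : IsWeight σ)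
    (a : EuclideanSpace ℝ (Fin n)) (l : ℝ) : weightMeasure σ (cube a l) ≠ ∞ :=
  (hσ.weightMeasure_lt_top (measurableSet_cube a l) (isBounded_cube a l)).ne

/-- The maximal function of `σ 1_T` dominates the average of `σ` over every cube inside `T`. -/
theorem IsWeight.average_le_maximalFunction {σ : EuclideanSpace ℝ (Fin n) → ℝ} (hσ : IsWeight σ)
    {T : Set (EuclideanSpace ℝ (Fin n))} {a : EuclideanSpace ℝ (Fin n)} {l : ℝ} (hl : 0 < l)
    (hT : cube a l ⊆ T) {x : EuclideanSpace ℝ (Fin n)} (hx : x ∈ cube a l) :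
    weightMeasure σ (cube a l) / volume (cube a l) ≤ maximalFunction (T.indicator σ) x := by
  refine le_trans (le_of_eq ?_) (le_iSup₂_of_le a l (le_iSup₂_of_le hl hx le_rfl))
  congr 1
  rw [weightMeasure, withDensity_apply _ (measurableSet_cube a l)]
  refine setLIntegral_congr_fun (measurableSet_cube a l) fun y hy => ?_
  simp only [indicator_of_mem (hT hy), Real.enorm_eq_ofReal (hσ.nonneg y)]

theorem IsWeight.rho_mul {σ : EuclideanSpace ℝ (Fin n) → ℝ} (hσ : IsWeight σ)
    {a : EuclideanSpace ℝ (Fin n)} {l : ℝ} (h0 : weightMeasure σ (cube a l) ≠ 0) :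
    rho σ (cube a l) * weightMeasure σ (cube a l) =
      ∫⁻ x in cube a l, maximalFunction ((cube a l).indicator σ) x :=
  ENNReal.div_mul_cancel h0 (hσ.weightMeasure_cube_ne_top a l)

/-- On Q the maximal function is at least the average over Q itself. This places ρ in the domain of
the entropy functions. -/
theorem IsWeight.one_le_rho {σ : EuclideanSpace ℝ (Fin n) → ℝ} (hσ : IsWeight σ)
    {a : EuclideanSpace ℝ (Fin n)} {l : ℝ} (hl : 0 < l)
    (h0 : weightMeasure σ (cube a l) ≠ 0) : 1 ≤ rho σ (cube a l) := by
  refine (ENNReal.mul_le_mul_iff_left h0 (hσ.weightMeasure_cube_ne_top a l)).1 ?_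
  rw [hσ.rho_mul h0, one_mul]
  calc weightMeasure σ (cube a l)
      = ∫⁻ x in cube a l, weightMeasure σ (cube a l) / volume (cube a l) := by
        rw [setLIntegral_const, ENNReal.div_mul_cancel (volume_cube_ne_zero a hl)
          (volume_cube_ne_top a l)]
    _ ≤ _ := setLIntegral_mono' (measurableSet_cube a l) fun x hx =>
        hσ.average_le_maximalFunction hl subset_rfl hx

theorem evalAt_ne_zero {s c : ℝ} (hc : 0 < c) {ε : ℝ → ℝ} (hε : IsEntropyFunction s c ε)
    {r : ℝ≥0∞} (hr : 1 ≤ r) : evalAt ε r ≠ 0 := by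
  unfold evalAt
  split_ifs with h
  · simp
  · have h1 : 1 ≤ r.toReal := by
      rw [← ENNReal.toReal_one]
      exact ENNReal.toReal_mono h hr
    have := hc.trans_le (hε.lower_bound _ h1)
    simpa using this

/-- The cubes of the dyadic grid with origin `o` and sides `L, L / 2, L / 4, …`. -/
def gridCube (L : ℝ) (o : Fin n → ℝ) (i : ℕ × (Fin n → ℤ)) : Set (EuclideanSpace ℝ (Fin n)) :=
  cube (WithLp.toLp 2 fun k => o k + L / 2 ^ i.1 * i.2 k) (L / 2 ^ i.1)

theorem mem_gridCube {L : ℝ} (hL : 0 < L) {o : Fin n → ℝ} {i : ℕ × (Fin n → ℤ)}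
    {x : EuclideanSpace ℝ (Fin n)} :
    x ∈ gridCube L o i ↔ ∀ k, ⌊(x k - o k) / (L / 2 ^ i.1)⌋ = i.2 k := by
  have hd : 0 < L / 2 ^ i.1 := by positivity
  refine forall_congr' fun k => ?_
  rw [Int.floor_eq_iff, le_div_iff₀ hd, div_lt_iff₀ hd]
  simp only
  constructor <;> rintro ⟨h1, h2⟩ <;> constructor <;> linarith

theorem floor_div_of_le {L : ℝ} {j j' : ℕ} (h : j ≤ j') (u : ℝ) :
    ⌊u / (L / 2 ^ j)⌋ = ⌊u / (L / 2 ^ j')⌋ / 2 ^ (j' - j) := by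
  have e : u / (L / 2 ^ j) = u / (L / 2 ^ j') / ((2 ^ (j' - j) : ℕ) : ℝ) := by
    push_cast
    have : (2 : ℝ) ^ j' = 2 ^ j * 2 ^ (j' - j) := by rw [← pow_add, Nat.add_sub_cancel' h]
    rw [this]
    by_cases hL : L = 0
    · simp [hL]
    field_simp
  rw [e, Int.floor_div_natCast]
  push_cast
  rfl

/-- A cube is determined by its level and the floors of the rescaled coordinates, and the floors at
a coarser level are integer quotients of the finer ones. A common point therefore forces inclusion.
-/
theorem isLaminar_gridCube {L : ℝ} (hL : 0 < L) (o : Fin n → ℝ) :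
    IsLaminar (gridCube L o) Prod.fst where
  measurableSet i := measurableSet_cube _ _
  nested := by
    rintro ⟨j, m⟩ ⟨j', m'⟩ hne hle
    simp only at hle
    by_cases hd : Disjoint (gridCube L o (j, m)) (gridCube L o (j', m'))
    · exact Or.inl hd
    refine Or.inr ?_
    obtain ⟨x, hx, hx'⟩ := Set.not_disjoint_iff.1 hd
    rw [mem_gridCube hL] at hx hx'
    simp only at hx hx'
    have hm : ∀ k, m k = m' k / 2 ^ (j' - j) := fun k => by
      rw [← hx k, ← hx' k, floor_div_of_le hle]
    constructor
    · refine lt_of_le_of_ne hle fun e => hne ?_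
      subst e
      congr 1
      ext k
      simpa using hm k
    · intro y hy
      rw [mem_gridCube hL] at hy ⊢
      intro k
      simp only at hy ⊢
      rw [floor_div_of_le hle, hy k, hm k]

end EntropyBump

/-! ### The dyadic bilinear form -/

namespace EntropyBump

variable {n : ℕ} {I : Type*} {Q : I → Set (EuclideanSpace ℝ (Fin n))} {lvl : I → ℕ}

/-- The constant in the Carleson embedding theorem with entropy weights. -/
noncomputable def entropyConst (p c : ℝ) : ℝ≥0 :=
  (carlesonConst p).toNNReal * (4 * ((c ^ (-p)).toNNReal + 2))

/-- The Carleson embedding theorem with entropy weights over a family of cubes that is sparse. -/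
theorem IsWeight.tsum_average_div_entropy_le [Countable I] (h : IsLaminar Q lvl)
    (hQ : ∀ i, ∃ a l, 0 < l ∧ Q i = cube a l) {σ : EuclideanSpace ℝ (Fin n) → ℝ}
    (hσ : IsWeight σ) {p c : ℝ} (hp : 1 < p) (hc : 0 < c) {ε : ℝ → ℝ}
    (hε : IsEntropyFunction p c ε) {Φ : Measure (EuclideanSpace ℝ (Fin n))}
    (hΦ : ∀ i, Φ (Q i) ≠ ∞) {S : Set I} (hS : IsDoubling Q lvl volume Φ S)
    (hS0 : ∀ i ∈ S, weightMeasure σ (Q i) ≠ 0) (hSt : ∀ i ∈ S, rho σ (Q i) ≠ ∞)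
    {φ : EuclideanSpace ℝ (Fin n) → ℝ≥0} (hφ : Measurable φ)
    (hfin : ∀ i, (weightMeasure σ).withDensity (fun x => φ x) (Q i) ≠ ∞) :
    ∑' i : S, weightMeasure σ (Q i) / (rho σ (Q i) * evalAt ε (rho σ (Q i)) ^ p) *
        ((weightMeasure σ).withDensity (fun x => φ x) (Q i) / weightMeasure σ (Q i)) ^ p ≤
      entropyConst p c * ∫⁻ x, (φ x : ℝ≥0∞) ^ p ∂(weightMeasure σ) := by
  have hp0 : 0 < p := by linarith
  set s := weightMeasure σ with hs
  have hst : ∀ i, s (Q i) ≠ ∞ := fun i => by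
    obtain ⟨a, l, hl, e⟩ := hQ i
    rw [e]; exact hσ.weightMeasure_cube_ne_top a l
  have hμ0 : ∀ i, volume (Q i) ≠ 0 := fun i => by
    obtain ⟨a, l, hl, e⟩ := hQ i
    rw [e]; exact volume_cube_ne_zero a hl
  have hμ : ∀ i, volume (Q i) ≠ ∞ := fun i => by
    obtain ⟨a, l, hl, e⟩ := hQ i
    rw [e]; exact volume_cube_ne_top a l
  have hρ1 : ∀ i ∈ S, 1 ≤ rho σ (Q i) := fun i hi => by
    have h0 := hS0 i hi
    obtain ⟨a, l, hl, e⟩ := hQ i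
    rw [e] at h0 ⊢
    exact hσ.one_le_rho hl h0
  have hexp : ∀ i, ∃ k : ℕ, i ∈ S → (2 : ℝ) ^ k ≤ (rho σ (Q i)).toReal ∧
      (rho σ (Q i)).toReal < 2 ^ (k + 1) := by
    intro i
    by_cases hi : i ∈ S
    · have h1 : 1 ≤ (rho σ (Q i)).toReal := by
        rw [← ENNReal.toReal_one]
        exact ENNReal.toReal_mono (hSt i hi) (hρ1 i hi)
      obtain ⟨k, hk⟩ := exists_nat_pow_near h1 (by norm_num : (1 : ℝ) < 2)
      exact ⟨k, fun _ => hk⟩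
    · exact ⟨0, fun h => absurd h hi⟩
  choose r hr using hexp
  have hcast : ∀ k : ℕ, ENNReal.ofReal ((2 : ℝ) ^ k) = 2 ^ k := fun k => by
    rw [ENNReal.ofReal_pow (by norm_num)]; simp
  set a : I → ℝ≥0∞ := fun i => s (Q i) / (rho σ (Q i) * evalAt ε (rho σ (Q i)) ^ p) with ha
  have hpack : ∀ P : I, ∑' i : ↥(S ∩ belowSet Q lvl P), a i ≤
      4 * (∑' k : ℕ, (ENNReal.ofReal (ε (2 ^ k)) ^ p)⁻¹) * s (Q P) := by
    intro P
    refine h.tsum_div_le_of_dyadic s S (fun i => rho σ (Q i))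
      (fun i => evalAt ε (rho σ (Q i)) ^ p) (fun k => ENNReal.ofReal (ε (2 ^ k)) ^ p) r ?_ ?_ P
    · intro i hi
      obtain ⟨h1, h2⟩ := hr i hi
      have e : rho σ (Q i) = ENNReal.ofReal (rho σ (Q i)).toReal :=
        (ENNReal.ofReal_toReal (hSt i hi)).symm
      refine ⟨?_, ?_, ?_⟩
      · rw [e, ← hcast]; exact ENNReal.ofReal_le_ofReal h1
      · rw [e, ← hcast]; exact ENNReal.ofReal_le_ofReal h2.le
      · simp only [evalAt, if_neg (hSt i hi)]
        have h3 : (1 : ℝ) ≤ 2 ^ r i := one_le_pow₀ (by norm_num)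
        have := hε.monotoneOn (show (2 : ℝ) ^ r i ∈ Ici 1 from h3)
          (show (rho σ (Q i)).toReal ∈ Ici 1 from h3.trans h1) h1
        gcongr
    -- Here the definition of entropy enters: sparseness bounds the sum below R by twice the
    -- integral of M(σ1_R) over R.
    · intro R hR
      have h0 := hS0 R hR
      obtain ⟨b, l, hl, e⟩ := hQ R
      have := h.tsum_measure_le_lintegral hμ0 hμ hΦ hS s R
        (maximalFunction ((Q R).indicator σ)) (fun i hi x hx => by
          obtain ⟨b', l', hl', e'⟩ := hQ i
          rw [e'] at hx ⊢
          exact hσ.average_le_maximalFunction hl' (e' ▸ hi.2) hx)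
      refine this.trans (le_of_eq ?_)
      rw [e] at h0 ⊢
      rw [hσ.rho_mul h0]
  have hsum := hε.tsum_inv_le hp0 hc
  -- Coefficients are set to 0 off S, so the packing condition holds at every cube of the grid and
  -- not only at those of S.
  have hcar := h.tsum_mul_average_rpow_le s hst hφ hfin hp (S.indicator a)
    (4 * (ENNReal.ofReal (c ^ (-p)) + 2)) (fun P => by
      calc ∑' i : belowSet Q lvl P, S.indicator a i
          = ∑' i : ↥(S ∩ belowSet Q lvl P), a i := by
            rw [tsum_subtype (belowSet Q lvl P) (S.indicator a),
              tsum_subtype (S ∩ belowSet Q lvl P) a, Set.indicator_indicator, Set.inter_comm]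
        _ ≤ _ := hpack P
        _ ≤ _ := by gcongr)
  calc ∑' i : S, a i * (s.withDensity (fun x => φ x) (Q i) / s (Q i)) ^ p
      = ∑' i, S.indicator a i * (s.withDensity (fun x => φ x) (Q i) / s (Q i)) ^ p := by
        rw [tsum_subtype S (fun i => a i * (s.withDensity (fun x => φ x) (Q i) / s (Q i)) ^ p)]
        refine tsum_congr fun i => ?_
        by_cases hi : i ∈ S <;> simp [hi]
    _ ≤ _ := hcar
    _ = _ := by
        rw [entropyConst]
        push_cast
        rfl

/-- The factors of the bump at a cube are distributed over two averages. -/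
theorem volume_rpow_mul_le_of_beta_le {α p p' q q' c : ℝ} (hpp : p.HolderConjugate p')
    (hqq : q.HolderConjugate q') (hc : 0 < c) {ε₁ ε₂ : ℝ → ℝ} (hε₁ : IsEntropyFunction p c ε₁)
    (hε₂ : IsEntropyFunction q' c ε₂) {σ w : EuclideanSpace ℝ (Fin n) → ℝ} (hσ : IsWeight σ)
    (hw : IsWeight w) {B : ℝ≥0∞} (hB : B ≠ ∞) {a : EuclideanSpace ℝ (Fin n)} {l : ℝ} (hl : 0 < l)
    {T : Set (EuclideanSpace ℝ (Fin n))} (hT : T = cube a l)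
    (hβ : beta α p p' q q' ε₁ ε₂ σ w T ≤ B)
    (hσ0 : weightMeasure σ T ≠ 0) (hw0 : weightMeasure w T ≠ 0) :
    rho σ T ≠ ∞ ∧ rho w T ≠ ∞ ∧ ∀ x y : ℝ≥0∞,
      volume T ^ (α / n - 1) * x * y ≤
        B * ((weightMeasure σ T /
            (rho σ T * evalAt ε₁ (rho σ T) ^ p) *
            (x / weightMeasure σ T) ^ p) ^ (1 / p) *
          (weightMeasure w T /
            (rho w T * evalAt ε₂ (rho w T) ^ q') *
            (y / weightMeasure w T) ^ q') ^ (1 / q')) := by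
  subst hT
  have hρσ := hσ.one_le_rho hl hσ0
  have hρw := hw.one_le_rho hl hw0
  have hE₁ := evalAt_ne_zero hc hε₁ hρσ
  have hE₂ := evalAt_ne_zero hc hε₂ hρw
  have hst := hσ.weightMeasure_cube_ne_top a l
  have htt := hw.weightMeasure_cube_ne_top a l
  have hV0 := volume_cube_ne_zero a hl
  have hVt := volume_cube_ne_top a l
  have hp := hpp.pos
  have hp' := hpp.symm.pos
  have hq := hqq.pos
  have hq' := hqq.symm.pos
  unfold beta at hβ
  -- An infinite entropy would make the corresponding bump factor infinite while all the others are
  -- nonzero, against `B ≠ ∞`.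
  have htop₁ : rho σ (cube a l) = ∞ → evalAt ε₁ (rho σ (cube a l)) = ∞ := fun e => by
    simp [evalAt, e]
  have htop₂ : rho w (cube a l) = ∞ → evalAt ε₂ (rho w (cube a l)) = ∞ := fun e => by
    simp [evalAt, e]
  generalize weightMeasure σ (cube a l) = s at *
  generalize weightMeasure w (cube a l) = t at *
  generalize volume (cube a l) = V at *
  generalize hgr : rho σ (cube a l) = ρ at *
  generalize hgr' : rho w (cube a l) = ρ' at *
  generalize evalAt ε₁ ρ = E at *
  generalize evalAt ε₂ ρ' = E' at *
  have hρ0 : ρ ≠ 0 := (zero_lt_one.trans_le hρσ).ne'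
  have hρ0' : ρ' ≠ 0 := (zero_lt_one.trans_le hρw).ne'
  set D := ρ ^ (1 / p) * E with hD
  set D' := ρ' ^ (1 / q') * E' with hD'
  have hρp : ρ ^ (1 / p) ≠ 0 := by simp [hρ0, hp.not_gt]
  have hρp' : ρ' ^ (1 / q') ≠ 0 := by simp [hρ0', hq'.not_gt]
  have hD0 : D ≠ 0 := mul_ne_zero hρp hE₁
  have hD0' : D' ≠ 0 := mul_ne_zero hρp' hE₂
  have hG0 : s ^ (1 / p') * t ^ (1 / q) * V ^ (α / n - 1) ≠ 0 := by
    refine mul_ne_zero (mul_ne_zero ?_ ?_) ?_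
    · simp [hσ0, hp'.not_gt]
    · simp [hw0, hq.not_gt]
    · simp [hV0, hVt]
  have hprod : s ^ (1 / p') * t ^ (1 / q) * V ^ (α / n - 1) * D * D' ≠ ∞ :=
    (hβ.trans_lt (lt_top_iff_ne_top.2 hB)).ne
  have hDt : D ≠ ∞ := by
    intro e
    refine hprod ?_
    rw [e, ENNReal.mul_top hG0, ENNReal.top_mul hD0']
  have hDt' : D' ≠ ∞ := by
    intro e
    refine hprod ?_
    rw [e, ENNReal.mul_top (mul_ne_zero hG0 hD0)]
  refine ⟨fun e => hDt ?_, fun e => hDt' ?_, fun x y => ?_⟩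
  · rw [hD, htop₁ e, ENNReal.mul_top hρp]
  · rw [hD', htop₂ e, ENNReal.mul_top hρp']
  have root : ∀ (r : ℝ), 0 < r → ∀ s ρ E u : ℝ≥0∞,
      (s / (ρ * E ^ r) * u ^ r) ^ (1 / r) = s ^ (1 / r) * (ρ ^ (1 / r) * E)⁻¹ * u := by
    intro r hr s ρ E u
    have hr' : 0 ≤ 1 / r := by positivity
    have e1 : ∀ z : ℝ≥0∞, (z ^ r) ^ (1 / r) = z := fun z => by
      rw [← ENNReal.rpow_mul, mul_one_div_cancel hr.ne', ENNReal.rpow_one]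
    rw [ENNReal.mul_rpow_of_nonneg _ _ hr', ENNReal.div_rpow_of_nonneg _ _ hr',
      ENNReal.mul_rpow_of_nonneg _ _ hr', e1, e1, div_eq_mul_inv]
  have split : ∀ (r r' : ℝ), r.HolderConjugate r' → ∀ s : ℝ≥0∞,
      s ^ (1 / r') * s ^ (1 / r) = s := by
    intro r r' hr s
    have h1 := hr.pos
    have h2 := hr.symm.pos
    rw [← ENNReal.rpow_add_of_nonneg _ _ (by positivity) (by positivity), one_div, one_div,
      add_comm, hr.inv_add_inv_eq_one, ENNReal.rpow_one]
  have hx : s ^ (1 / p') * s ^ (1 / p) * (x / s) = x := by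
    rw [split p p' hpp, ENNReal.mul_div_cancel hσ0 hst]
  have hy : t ^ (1 / q) * t ^ (1 / q') * (y / t) = y := by
    rw [split q' q hqq.symm, ENNReal.mul_div_cancel hw0 htt]
  rw [root p hp, root q' hq']
  -- Insert D D⁻¹ and D' D'⁻¹ and split s = s^{1/p'} s^{1/p}, t = t^{1/q} t^{1/q'}: one factor from
  -- each split, with V, D and D', assembles β, and the rest are the two roots.
  calc V ^ (α / n - 1) * x * y
      = V ^ (α / n - 1) * (s ^ (1 / p') * s ^ (1 / p) * (x / s)) *
          (t ^ (1 / q) * t ^ (1 / q') * (y / t)) * (D * D⁻¹) * (D' * D'⁻¹) := by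
        rw [hx, hy, ENNReal.mul_inv_cancel hD0 hDt, ENNReal.mul_inv_cancel hD0' hDt', mul_one,
          mul_one]
    _ = s ^ (1 / p') * t ^ (1 / q) * V ^ (α / n - 1) * D * D' *
          (s ^ (1 / p) * D⁻¹ * (x / s) * (t ^ (1 / q') * D'⁻¹ * (y / t))) := by ring
    _ ≤ _ := by gcongr

/-- On a cube of finite measure, φ ≤ 1 + φ^p suffices. -/
theorem withDensity_cube_ne_top {σ : EuclideanSpace ℝ (Fin n) → ℝ} (hσ : IsWeight σ) {p : ℝ}
    (hp : 1 ≤ p) {φ : EuclideanSpace ℝ (Fin n) → ℝ≥0}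
    (hφp : ∫⁻ x, (φ x : ℝ≥0∞) ^ p ∂(weightMeasure σ) ≠ ∞) (a : EuclideanSpace ℝ (Fin n)) (l : ℝ) :
    (weightMeasure σ).withDensity (fun x => φ x) (cube a l) ≠ ∞ := by
  rw [withDensity_apply _ (measurableSet_cube a l)]
  refine ne_top_of_le_ne_top (ENNReal.add_ne_top.2
    ⟨hσ.weightMeasure_cube_ne_top a l, hφp⟩) ?_
  calc ∫⁻ x in cube a l, (φ x : ℝ≥0∞) ∂(weightMeasure σ)
      ≤ ∫⁻ x in cube a l, (1 + (φ x : ℝ≥0∞) ^ p) ∂(weightMeasure σ) := by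
        refine lintegral_mono fun x => ?_
        rcases le_total (φ x : ℝ≥0∞) 1 with h1 | h1
        · exact h1.trans le_self_add
        · refine le_trans ?_ le_add_self
          simpa using ENNReal.rpow_le_rpow_of_exponent_le h1 hp
    _ = weightMeasure σ (cube a l) + ∫⁻ x in cube a l, (φ x : ℝ≥0∞) ^ p ∂(weightMeasure σ) := by
        rw [lintegral_add_left measurable_const]; simp
    _ ≤ _ := by gcongr; exact Measure.restrict_le_self

/-- The estimate for the dyadic bilinear form. -/
theorem tsum_dyadic_form_le [Countable I] (h : IsLaminar Q lvl)
    (hQ : ∀ i, ∃ a l, 0 < l ∧ Q i = cube a l) {α p p' q q' c : ℝ}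
    (θ : ℕ → ℝ≥0∞) {C : ℝ≥0∞} (hθ : ∀ j, ∑' k, θ (j + k) ≤ C * θ j)
    (hvol : ∀ i, volume (Q i) ^ (α / n) = θ (lvl i))
    (hpp : p.HolderConjugate p') (hqq : q.HolderConjugate q') (hpq : p ≤ q) (hc : 0 < c)
    {ε₁ ε₂ : ℝ → ℝ} (hε₁ : IsEntropyFunction p c ε₁)
    (hε₂ : IsEntropyFunction q' c ε₂) {σ w : EuclideanSpace ℝ (Fin n) → ℝ} (hσ : IsWeight σ)
    (hw : IsWeight w) (hB : bumpConstant α p p' q q' ε₁ ε₂ σ w ≠ ∞)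
    {φ g : EuclideanSpace ℝ (Fin n) → ℝ≥0} (hφ : Measurable φ) (hg : Measurable g)
    (hφp : ∫⁻ x, (φ x : ℝ≥0∞) ^ p ∂(weightMeasure σ) ≠ ∞)
    (hgq : ∫⁻ x, (g x : ℝ≥0∞) ^ q' ∂(weightMeasure w) ≠ ∞) :
    ∑' i, volume (Q i) ^ (α / n - 1) * (weightMeasure σ).withDensity (fun x => φ x) (Q i) *
        (weightMeasure w).withDensity (fun x => g x) (Q i) ≤
      4 * C * bumpConstant α p p' q q' ε₁ ε₂ σ w *
        ((entropyConst p c * ∫⁻ x, (φ x : ℝ≥0∞) ^ p ∂(weightMeasure σ)) ^ (1 / p) *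
         (entropyConst q' c * ∫⁻ x, (g x : ℝ≥0∞) ^ q' ∂(weightMeasure w)) ^ (1 / q')) := by
  set B := bumpConstant α p p' q q' ε₁ ε₂ σ w with hBdef
  set s := weightMeasure σ with hs
  set t := weightMeasure w with ht
  set Φ := s.withDensity (fun x => (φ x : ℝ≥0∞)) with hΦ
  set ν := t.withDensity (fun x => (g x : ℝ≥0∞)) with hν
  have hμ0 : ∀ i, volume (Q i) ≠ 0 := fun i => by
    obtain ⟨a, l, hl, e⟩ := hQ i
    rw [e]; exact volume_cube_ne_zero a hl
  have hμ : ∀ i, volume (Q i) ≠ ∞ := fun i => by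
    obtain ⟨a, l, hl, e⟩ := hQ i
    rw [e]; exact volume_cube_ne_top a l
  have hΦt : ∀ i, Φ (Q i) ≠ ∞ := fun i => by
    obtain ⟨a, l, hl, e⟩ := hQ i
    rw [e]; exact withDensity_cube_ne_top hσ hpp.lt.le hφp a l
  have hνt : ∀ i, ν (Q i) ≠ ∞ := fun i => by
    obtain ⟨a, l, hl, e⟩ := hQ i
    rw [e]; exact withDensity_cube_ne_top hw hqq.symm.lt.le hgq a l
  have hterm : ∀ i, volume (Q i) ^ (α / n - 1) * Φ (Q i) * ν (Q i) =
      θ (lvl i) * (Φ (Q i) / volume (Q i)) * ν (Q i) := by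
    intro i
    rw [← hvol, ENNReal.rpow_sub _ _ (hμ0 i) (hμ i), ENNReal.rpow_one]
    simp only [ENNReal.div_eq_inv_mul]
    ring
  obtain ⟨S₀, S₁, hS₀, hS₁, hdom⟩ := h.exists_sparse_domination hμ0 hμ hΦt θ C hθ ν
  have main : ∀ S : Set I, IsDoubling Q lvl volume Φ S →
      ∑' i : S, θ (lvl i) * (Φ (Q i) / volume (Q i)) * ν (Q i) ≤
        B * ((entropyConst p c * ∫⁻ x, (φ x : ℝ≥0∞) ^ p ∂s) ^ (1 / p) *
         (entropyConst q' c * ∫⁻ x, (g x : ℝ≥0∞) ^ q' ∂t) ^ (1 / q')) := by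
    intro S hS
    -- Cubes null for σ or w contribute nothing; on the others both entropies are at least 1 and the
    -- bump controls the term.
    set S' : Set I := {i | i ∈ S ∧ s (Q i) ≠ 0 ∧ t (Q i) ≠ 0} with hS'
    have hdS' : IsDoubling Q lvl volume Φ S' :=
      ⟨fun i hi => hS.ne_zero i hi.1, fun i hi j hj => hS.doubling i hi.1 j hj.1⟩
    have hbeta := fun i (hi : i ∈ S') => volume_rpow_mul_le_of_beta_le hpp hqq hc hε₁ hε₂ hσ hw hB
      (hQ i).choose_spec.choose_spec.1 (hQ i).choose_spec.choose_spec.2 (by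
        rw [(hQ i).choose_spec.choose_spec.2]
        exact le_iSup₂_of_le _ _ (le_iSup_of_le (hQ i).choose_spec.choose_spec.1 le_rfl))
      hi.2.1 hi.2.2
    set x : I → ℝ≥0∞ := fun i => s (Q i) / (rho σ (Q i) * evalAt ε₁ (rho σ (Q i)) ^ p) *
        (Φ (Q i) / s (Q i)) ^ p with hx
    set y : I → ℝ≥0∞ := fun i => t (Q i) / (rho w (Q i) * evalAt ε₂ (rho w (Q i)) ^ q') *
        (ν (Q i) / t (Q i)) ^ q' with hy
    have root : ∀ (r : ℝ), 0 < r → ∀ u : ℝ≥0∞, (u ^ (1 / r)) ^ r = u := fun r hr u => by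
      rw [← ENNReal.rpow_mul, one_div_mul_cancel hr.ne', ENNReal.rpow_one]
    have hp0 := hpp.pos
    have hq0 := hqq.symm.pos
    -- The assumption p ≤ q enters here, to allow Hölder with the exponents p and q'.
    have hqp : q' ≤ p' := by
      have h1 := hpp.inv_add_inv_eq_one
      have h2 := hqq.inv_add_inv_eq_one
      have h3 : q⁻¹ ≤ p⁻¹ := inv_anti₀ hp0 hpq
      exact (inv_le_inv₀ hpp.symm.pos hq0).1 (by linarith)
    set τ : I → ℝ≥0∞ := fun i => volume (Q i) ^ (α / n - 1) * Φ (Q i) * ν (Q i) with hτ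
    calc ∑' i : S, θ (lvl i) * (Φ (Q i) / volume (Q i)) * ν (Q i)
        = ∑' i : S, τ i := tsum_congr fun i => (hterm i).symm
      _ = ∑' i : S', τ i := by
          rw [tsum_subtype S τ, tsum_subtype S' τ]
          refine tsum_congr fun i => ?_
          by_cases hi : i ∈ S
          · by_cases hi' : i ∈ S'
            · rw [indicator_of_mem hi, indicator_of_mem hi']
            · rw [indicator_of_mem hi, indicator_of_notMem hi']
              have : s (Q i) = 0 ∨ t (Q i) = 0 := by
                by_contra hcon
                push Not at hcon
                exact hi' ⟨hi, hcon⟩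
              rcases this with h0 | h0
              · have : Φ (Q i) = 0 := withDensity_absolutelyContinuous s _ h0
                simp [hτ, this]
              · have : ν (Q i) = 0 := withDensity_absolutelyContinuous t _ h0
                simp [hτ, this]
          · rw [indicator_of_notMem hi, indicator_of_notMem fun hi' => hi hi'.1]
      _ ≤ ∑' i : S', B * (x i ^ (1 / p) * y i ^ (1 / q')) :=
          ENNReal.tsum_le_tsum fun i => (hbeta i i.2).2.2 _ _
      _ = B * ∑' i : S', x i ^ (1 / p) * y i ^ (1 / q') := ENNReal.tsum_mul_left
      _ ≤ B * ((∑' i : S', (x i ^ (1 / p)) ^ p) ^ (1 / p) *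
            (∑' i : S', (y i ^ (1 / q')) ^ q') ^ (1 / q')) := by
          gcongr
          exact ENNReal.tsum_mul_le_of_le_conjExponent hpp hq0 hqp
            (fun i : S' => x i ^ (1 / p)) (fun i : S' => y i ^ (1 / q'))
      _ = B * ((∑' i : S', x i) ^ (1 / p) * (∑' i : S', y i) ^ (1 / q')) := by
          simp only [root p hp0, root q' hq0]
      _ ≤ _ := by
          -- Both embeddings use the same subfamily, chosen through averages of φσ alone.
          gcongr
          · exact hσ.tsum_average_div_entropy_le h hQ hpp.lt hc hε₁ hΦt hdS'
              (fun i hi => hi.2.1) (fun i hi => (hbeta i hi).1) hφ hΦt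
          · exact hw.tsum_average_div_entropy_le h hQ hqq.symm.lt hc hε₂ hΦt hdS'
              (fun i hi => hi.2.2) (fun i hi => (hbeta i hi).2.1) hg hνt
  calc ∑' i, volume (Q i) ^ (α / n - 1) * Φ (Q i) * ν (Q i)
      = ∑' i, θ (lvl i) * (Φ (Q i) / volume (Q i)) * ν (Q i) := tsum_congr hterm
    _ ≤ _ := hdom
    _ ≤ 2 * C * (B * ((entropyConst p c * ∫⁻ x, (φ x : ℝ≥0∞) ^ p ∂s) ^ (1 / p) *
         (entropyConst q' c * ∫⁻ x, (g x : ℝ≥0∞) ^ q' ∂t) ^ (1 / q')) +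
         B * ((entropyConst p c * ∫⁻ x, (φ x : ℝ≥0∞) ^ p ∂s) ^ (1 / p) *
         (entropyConst q' c * ∫⁻ x, (g x : ℝ≥0∞) ^ q' ∂t) ^ (1 / q'))) := by
        gcongr
        · exact main S₀ hS₀
        · exact main S₁ hS₁
    _ = _ := by ring

end EntropyBump

/-! ### Duality -/

/-- The converse of Hölder's inequality. -/
theorem MeasureTheory.lintegral_rpow_le_of_forall_lintegral_mul_le {X : Type*} [MeasurableSpace X]
    (μ : Measure X) [SigmaFinite μ] {q q' : ℝ} (hq : q.HolderConjugate q') {F : X → ℝ≥0∞}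
    (hF : Measurable F) {C : ℝ≥0∞}
    (h : ∀ g : X → ℝ≥0, Measurable g → ∫⁻ x, (g x : ℝ≥0∞) ^ q' ∂μ ≠ ∞ →
      ∫⁻ x, F x * g x ∂μ ≤ C * (∫⁻ x, (g x : ℝ≥0∞) ^ q' ∂μ) ^ (1 / q')) :
    (∫⁻ x, F x ^ q ∂μ) ^ (1 / q) ≤ C := by
  have hq0 := hq.pos
  have hq0' := hq.symm.pos
  have hq1 : 0 < q - 1 := hq.sub_one_pos
  -- Truncation in height and to a set of finite measure makes the norm finite, so that it can be
  -- cancelled.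
  set Fk : ℕ → X → ℝ≥0∞ := fun k => (spanningSets μ k).indicator fun x => min (F x) k with hFk
  have hFk_le : ∀ k x, Fk k x ≤ k := fun k x =>
    indicator_le' (fun _ _ => min_le_right _ _) (fun _ _ => by simp) x
  have hFk_le' : ∀ k x, Fk k x ≤ F x := fun k x =>
    indicator_le' (fun _ _ => min_le_left _ _) (fun _ _ => by simp) x
  have hFk_top : ∀ k x, Fk k x ≠ ∞ := fun k x =>
    ((hFk_le k x).trans_lt (ENNReal.natCast_lt_top k)).ne
  have hFk_meas : ∀ k, Measurable (Fk k) := fun k =>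
    (hF.min measurable_const).indicator (measurableSet_spanningSets μ k)
  have hmono : Monotone fun k x => Fk k x ^ q := by
    intro k l hkl x
    refine ENNReal.rpow_le_rpow ?_ hq0.le
    by_cases hx : x ∈ spanningSets μ k
    · simp only [hFk, indicator_of_mem hx, indicator_of_mem (monotone_spanningSets μ hkl hx)]
      gcongr
    · simp [hFk, indicator_of_notMem hx]
  have hsup : ∀ x, F x ^ q ≤ ⨆ k, Fk k x ^ q := by
    intro x
    obtain ⟨k₀, hk₀⟩ := mem_iUnion.1 ((iUnion_spanningSets μ).symm ▸ mem_univ x)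
    refine le_of_forall_lt fun b hb => ?_
    obtain ⟨b', hbb', hb'⟩ := exists_between hb
    refine hbb'.trans_le ?_
    have h1 : b' ^ (1 / q) < F x := by
      rw [one_div]
      exact (ENNReal.rpow_inv_lt_iff hq0).2 hb'
    obtain ⟨m, hm⟩ := ENNReal.exists_nat_gt h1.ne_top
    refine le_iSup_of_le (max m k₀) ?_
    have hx : x ∈ spanningSets μ (max m k₀) := monotone_spanningSets μ (le_max_right _ _) hk₀
    have h2 : b' ^ (1 / q) ≤ Fk (max m k₀) x := by
      simp only [hFk, indicator_of_mem hx]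
      refine le_min h1.le (hm.le.trans ?_)
      exact_mod_cast le_max_left m k₀
    calc b' = (b' ^ (1 / q)) ^ q := by
          rw [← ENNReal.rpow_mul, one_div_mul_cancel hq0.ne', ENNReal.rpow_one]
      _ ≤ _ := by gcongr
  have hk : ∀ k, ∫⁻ x, Fk k x ^ q ∂μ ≤ C ^ q := by
    intro k
    set N := ∫⁻ x, Fk k x ^ q ∂μ with hN
    have hNt : N ≠ ∞ := by
      have hle : N ≤ ∫⁻ x in spanningSets μ k, (k : ℝ≥0∞) ^ q ∂μ := by
        rw [← lintegral_indicator (measurableSet_spanningSets μ k)]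
        refine lintegral_mono fun x => ?_
        by_cases hx : x ∈ spanningSets μ k
        · rw [indicator_of_mem hx]
          exact ENNReal.rpow_le_rpow (hFk_le k x) hq0.le
        · simp [hFk, indicator_of_notMem hx, hq0]
      refine ne_top_of_le_ne_top ?_ hle
      rw [setLIntegral_const]
      exact ENNReal.mul_ne_top (ENNReal.rpow_ne_top_of_nonneg hq0.le (ENNReal.natCast_ne_top k))
        (measure_spanningSets_lt_top μ k).ne
    have hcoe : ∀ x, (((Fk k x ^ (q - 1)).toNNReal : ℝ≥0) : ℝ≥0∞) = Fk k x ^ (q - 1) := fun x =>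
      ENNReal.coe_toNNReal (ENNReal.rpow_ne_top_of_nonneg hq1.le (hFk_top k x))
    have hpow : ∀ x, (Fk k x ^ (q - 1)) ^ q' = Fk k x ^ q := fun x => by
      rw [← ENNReal.rpow_mul, hq.sub_one_mul_conj]
    -- The extremal test function is F^{q-1}, truncated; since (q-1)q' = q it gives N ≤ C N^{1/q'}.
    have h1 := h (fun x => (Fk k x ^ (q - 1)).toNNReal)
      (((hFk_meas k).pow_const _).ennreal_toNNReal) (by simpa only [hcoe, hpow] using hNt)
    simp only [hcoe, hpow] at h1
    have h2 : N ≤ C * N ^ (1 / q') := by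
      refine le_trans (lintegral_mono fun x => ?_) h1
      calc Fk k x ^ q = Fk k x * Fk k x ^ (q - 1) := by
            conv_rhs => lhs; rw [← ENNReal.rpow_one (Fk k x)]
            rw [← ENNReal.rpow_add_of_nonneg _ _ zero_le_one hq1.le]
            congr 1; ring
        _ ≤ _ := by gcongr; exact hFk_le' k x
    by_cases hN0 : N = 0
    · rw [hN0]; exact zero_le
    have h3 : N ^ (1 / q) * N ^ (1 / q') ≤ C * N ^ (1 / q') := by
      refine le_of_eq_of_le ?_ h2
      rw [← ENNReal.rpow_add_of_nonneg _ _ (by positivity) (by positivity), one_div, one_div,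
        hq.inv_add_inv_eq_one, ENNReal.rpow_one]
    have h4 : N ^ (1 / q) ≤ C :=
      (ENNReal.mul_le_mul_iff_left (by simp [hN0, hq0'.not_gt])
        (ENNReal.rpow_ne_top_of_nonneg (by positivity) hNt)).1 h3
    calc N = (N ^ (1 / q)) ^ q := by
          rw [← ENNReal.rpow_mul, one_div_mul_cancel hq0.ne', ENNReal.rpow_one]
      _ ≤ _ := by gcongr
  calc (∫⁻ x, F x ^ q ∂μ) ^ (1 / q) ≤ (⨆ k, ∫⁻ x, Fk k x ^ q ∂μ) ^ (1 / q) := by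
        gcongr
        rw [← lintegral_iSup (fun k => (hFk_meas k).pow_const _) hmono]
        exact lintegral_mono hsup
    _ ≤ (C ^ q) ^ (1 / q) := by
        gcongr
        exact iSup_le hk
    _ = C := by rw [← ENNReal.rpow_mul, mul_one_div_cancel hq0.ne', ENNReal.rpow_one]

/-! ### From the kernel to dyadic forms: adjacent grids -/

namespace EntropyBump

variable {n : ℕ}

/-- The kernel of the fractional integral operator. -/
noncomputable def fracWeight (α : ℝ) (x y : EuclideanSpace ℝ (Fin n)) : ℝ≥0∞ :=
  ENNReal.ofReal ((‖y - x‖ ^ ((n : ℝ) - α))⁻¹)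

theorem measurable_fracWeight (α : ℝ) : Measurable fun z : EuclideanSpace ℝ (Fin n) ×
    EuclideanSpace ℝ (Fin n) => fracWeight α z.1 z.2 := by
  unfold fracWeight
  fun_prop

theorem measurable_fracWeight_left (α : ℝ) (x : EuclideanSpace ℝ (Fin n)) :
    Measurable fun y => fracWeight α x y := by
  unfold fracWeight
  fun_prop

/-- The origins of the adjacent dyadic grids. -/
noncomputable def gridOrigin (L : ℝ) (τ : Fin n → Bool) (k : Fin n) : ℝ := if τ k then L / 3 else 0

/-- The one-third trick. -/
theorem exists_floor_eq {L : ℝ} (hL : 0 < L) (j : ℕ) {u v : ℝ} (h : |u - v| ≤ L / 2 ^ j / 3) :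
    ∃ b : Bool, ⌊(u - if b then L / 3 else 0) / (L / 2 ^ j)⌋ =
      ⌊(v - if b then L / 3 else 0) / (L / 2 ^ j)⌋ := by
  wlog huv : u ≤ v generalizing u v
  · obtain ⟨b, hb⟩ := this (by rwa [abs_sub_comm]) (le_of_not_ge huv)
    exact ⟨b, hb.symm⟩
  have hd : 0 < L / 2 ^ j := by positivity
  by_contra! hcon
  have h0 := hcon false
  have h1 := hcon true
  simp only [Bool.false_eq_true, if_false, if_true, sub_zero] at h0 h1
  have e : L / 3 / (L / 2 ^ j) = 2 ^ j / 3 := by field_simp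
  rw [sub_div, sub_div, e] at h1
  have hle : v / (L / 2 ^ j) ≤ u / (L / 2 ^ j) + 1 / 3 := by
    have : v ≤ u + L / 2 ^ j / 3 := by
      rw [abs_sub_comm, abs_of_nonneg (by linarith)] at h
      linarith
    calc v / (L / 2 ^ j) ≤ (u + L / 2 ^ j / 3) / (L / 2 ^ j) := by gcongr
      _ = _ := by field_simp
  have hge : u / (L / 2 ^ j) ≤ v / (L / 2 ^ j) := by gcongr
  generalize u / (L / 2 ^ j) = a at *
  generalize v / (L / 2 ^ j) = b at *
  have h0' : ⌊a⌋ < ⌊b⌋ := lt_of_le_of_ne (Int.floor_mono hge) h0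
  have h1' : ⌊a - 2 ^ j / 3⌋ < ⌊b - 2 ^ j / 3⌋ :=
    lt_of_le_of_ne (Int.floor_mono (by linarith)) h1
  have a0 : a < ⌊b⌋ := Int.floor_lt.1 h0'
  have a1 : a - 2 ^ j / 3 < ⌊b - 2 ^ j / 3⌋ := Int.floor_lt.1 h1'
  have b0 := Int.floor_le b
  have b1 := Int.floor_le (b - 2 ^ j / 3)
  generalize ⌊b⌋ = m at *
  generalize ⌊b - 2 ^ j / 3⌋ = m' at *
  -- If both grids separate the points, rescaled to distance at most 1/3, then m and m' + 2^j/3 lie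
  -- in the same interval (a, b]. So 3(m - m') - 2^j is an integer in (-1, 1), and 3 would divide
  -- 2^j.
  have c1 : (3 * (m - m') : ℤ) - 2 ^ j < 1 := by
    have : ((3 * (m - m') - 2 ^ j : ℤ) : ℝ) < ((1 : ℤ) : ℝ) := by push_cast; linarith
    exact_mod_cast this
  have c2 : -1 < (3 * (m - m') : ℤ) - 2 ^ j := by
    have : ((-1 : ℤ) : ℝ) < ((3 * (m - m') - 2 ^ j : ℤ) : ℝ) := by push_cast; linarith
    exact_mod_cast this
  have c3 : (3 : ℤ) ∣ 2 ^ j := ⟨m - m', by omega⟩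
  have := Int.Prime.dvd_pow' Nat.prime_three c3
  norm_num at this

theorem volume_gridCube_rpow {L : ℝ} (hL : 0 < L) (o : Fin n → ℝ)
    (i : ℕ × (Fin n → ℤ)) (r : ℝ) :
    volume (gridCube L o i) ^ r = ENNReal.ofReal ((L / 2 ^ i.1) ^ (n * r)) := by
  have hd : 0 < L / 2 ^ i.1 := by positivity
  rw [gridCube, volume_cube, ← ENNReal.rpow_natCast, ← ENNReal.rpow_mul,
    ENNReal.ofReal_rpow_of_pos hd]

/-- The kernel is dominated near the diagonal by the kernels of finitely many dyadic
operators. -/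
theorem fracWeight_le_sum {α : ℝ} (hαn : α < n) (hn : n ≠ 0) {L : ℝ} (hL : 0 < L)
    {x y : EuclideanSpace ℝ (Fin n)} (hxy : ‖y - x‖ ≤ L / 3) :
    fracWeight α x y ≤ ENNReal.ofReal (6 ^ ((n : ℝ) - α)) * ∑ τ : Fin n → Bool,
      ∑' i, volume (gridCube L (gridOrigin L τ) i) ^ (α / n - 1) *
        ((gridCube L (gridOrigin L τ) i).indicator 1 x *
          (gridCube L (gridOrigin L τ) i).indicator 1 y) := by
  have hexp : 0 < (n : ℝ) - α := by linarith
  -- On the diagonal the kernel takes the default value 0⁻¹ = 0.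
  by_cases hr : ‖y - x‖ = 0
  · simp [fracWeight, hr, Real.zero_rpow hexp.ne']
  have hr0 : 0 < ‖y - x‖ := lt_of_le_of_ne (norm_nonneg _) (Ne.symm hr)
  have h1 : 1 ≤ L / (3 * ‖y - x‖) := by
    rw [one_le_div (by positivity)]
    linarith
  -- The level is chosen so that the distance lies between 1/6 and 1/3 of the side: 1/3 suits the
  -- one-third trick, and 1/6 produces the constant 6^{n-α}.
  obtain ⟨j, hj1, hj2⟩ := exists_nat_pow_near h1 (by norm_num : (1 : ℝ) < 2)
  have h2j : (0 : ℝ) < 2 ^ j := by positivity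
  rw [le_div_iff₀ (by positivity)] at hj1
  rw [div_lt_iff₀ (by positivity), pow_succ] at hj2
  have hup : ‖y - x‖ ≤ L / 2 ^ j / 3 := by
    rw [le_div_iff₀ (by norm_num), le_div_iff₀ h2j]
    linarith
  have hlow : L / 2 ^ j / 6 ≤ ‖y - x‖ := by
    rw [div_le_iff₀ (by norm_num), div_le_iff₀ h2j]
    linarith
  -- Each coordinate chooses its own shift, which is why 2^n grids are needed.
  have hcoord : ∀ k, ∃ b : Bool, ⌊(x k - if b then L / 3 else 0) / (L / 2 ^ j)⌋ =
      ⌊(y k - if b then L / 3 else 0) / (L / 2 ^ j)⌋ := fun k => by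
    refine exists_floor_eq hL j (le_trans ?_ hup)
    rw [abs_sub_comm]
    exact PiLp.norm_apply_le (y - x) k
  choose τ hτ using hcoord
  set i : ℕ × (Fin n → ℤ) := (j, fun k => ⌊(x k - gridOrigin L τ k) / (L / 2 ^ j)⌋) with hi
  have hx : x ∈ gridCube L (gridOrigin L τ) i := (mem_gridCube hL).2 fun k => rfl
  have hy : y ∈ gridCube L (gridOrigin L τ) i := (mem_gridCube hL).2 fun k => (hτ k).symm
  have hmain : fracWeight α x y ≤ ENNReal.ofReal (6 ^ ((n : ℝ) - α)) *
      volume (gridCube L (gridOrigin L τ) i) ^ (α / n - 1) := by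
    have hd : 0 < L / 2 ^ j := by positivity
    rw [volume_gridCube_rpow hL, ← ENNReal.ofReal_mul (by positivity)]
    refine ENNReal.ofReal_le_ofReal ?_
    have e : (n : ℝ) * (α / n - 1) = -((n : ℝ) - α) := by
      have : (n : ℝ) ≠ 0 := by exact_mod_cast hn
      field_simp; ring
    rw [e, Real.rpow_neg hd.le]
    calc (‖y - x‖ ^ ((n : ℝ) - α))⁻¹ ≤ ((L / 2 ^ j / 6) ^ ((n : ℝ) - α))⁻¹ := by gcongr
      _ = _ := by
        rw [Real.div_rpow hd.le (by norm_num), inv_div, div_eq_mul_inv]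
  refine hmain.trans ?_
  gcongr
  refine le_trans ?_ (Finset.single_le_sum (f := fun τ : Fin n → Bool =>
    ∑' i, volume (gridCube L (gridOrigin L τ) i) ^ (α / n - 1) *
        ((gridCube L (gridOrigin L τ) i).indicator (1 : EuclideanSpace ℝ (Fin n) → ℝ≥0∞) x *
          (gridCube L (gridOrigin L τ) i).indicator 1 y)) (fun _ _ => zero_le)
    (Finset.mem_univ τ))
  refine le_trans ?_ (ENNReal.le_tsum i)
  simp [hx, hy]

instance (σ : EuclideanSpace ℝ (Fin n) → ℝ) : SigmaFinite (weightMeasure σ) :=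
  SigmaFinite.withDensity_ofReal σ

theorem IsWeight.aemeasurable {σ : EuclideanSpace ℝ (Fin n) → ℝ} (hσ : IsWeight σ) :
    AEMeasurable σ volume :=
  hσ.locallyIntegrable.aestronglyMeasurable.aemeasurable

/-- Integrating the pointwise kernel bound, each 1_Q(x) 1_Q(y) factors into a product of two masses
by Tonelli. -/
theorem setLIntegral_fracWeight_le {α : ℝ} (hαn : α < n) (hn : n ≠ 0) {L : ℝ} (hL : 0 < L)
    (s t : Measure (EuclideanSpace ℝ (Fin n))) [SFinite s] [SFinite t]
    {φ g : EuclideanSpace ℝ (Fin n) → ℝ≥0} (hφ : Measurable φ) (hg : Measurable g) :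
    ∫⁻ z in {z : EuclideanSpace ℝ (Fin n) × EuclideanSpace ℝ (Fin n) | ‖z.2 - z.1‖ ≤ L / 3},
        fracWeight α z.1 z.2 * (φ z.2 * g z.1) ∂(t.prod s) ≤
      ENNReal.ofReal (6 ^ ((n : ℝ) - α)) * ∑ τ : Fin n → Bool,
        ∑' i, volume (gridCube L (gridOrigin L τ) i) ^ (α / n - 1) *
          s.withDensity (fun x => φ x) (gridCube L (gridOrigin L τ) i) *
          t.withDensity (fun x => g x) (gridCube L (gridOrigin L τ) i) := by
  have hms : MeasurableSet {z : EuclideanSpace ℝ (Fin n) × EuclideanSpace ℝ (Fin n) |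
      ‖z.2 - z.1‖ ≤ L / 3} := measurableSet_le (by fun_prop) measurable_const
  have hQ : ∀ τ i, MeasurableSet (gridCube L (gridOrigin L (n := n) τ) i) := fun τ i =>
    measurableSet_cube _ _
  set ind : (Fin n → Bool) → ℕ × (Fin n → ℤ) → EuclideanSpace ℝ (Fin n) → ℝ≥0∞ :=
    fun τ i => (gridCube L (gridOrigin L τ) i).indicator 1 with hind
  have hindm : ∀ τ i, Measurable (ind τ i) := fun τ i =>
    measurable_one.indicator (hQ τ i)
  have hterm : ∀ τ i, Measurable fun z : EuclideanSpace ℝ (Fin n) × EuclideanSpace ℝ (Fin n) =>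
      volume (gridCube L (gridOrigin L τ) i) ^ (α / n - 1) *
        ((ind τ i z.1 * g z.1) * (ind τ i z.2 * φ z.2)) := fun τ i => by
    have := hindm τ i
    fun_prop
  calc ∫⁻ z in {z : EuclideanSpace ℝ (Fin n) × EuclideanSpace ℝ (Fin n) | ‖z.2 - z.1‖ ≤ L / 3},
        fracWeight α z.1 z.2 * (φ z.2 * g z.1) ∂(t.prod s)
      ≤ ∫⁻ z in {z : EuclideanSpace ℝ (Fin n) × EuclideanSpace ℝ (Fin n) | ‖z.2 - z.1‖ ≤ L / 3},
          ENNReal.ofReal (6 ^ ((n : ℝ) - α)) * ∑ τ : Fin n → Bool,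
            ∑' i, volume (gridCube L (gridOrigin L τ) i) ^ (α / n - 1) *
              ((ind τ i z.1 * g z.1) * (ind τ i z.2 * φ z.2)) ∂(t.prod s) := by
        refine setLIntegral_mono' hms fun z hz => ?_
        calc fracWeight α z.1 z.2 * (φ z.2 * g z.1) ≤ _ * (φ z.2 * g z.1) :=
              mul_le_mul_left (fracWeight_le_sum hαn hn hL hz) _
          _ = _ := by
              rw [mul_assoc, Finset.sum_mul]
              congr 1
              refine Finset.sum_congr rfl fun τ _ => ?_
              rw [← ENNReal.tsum_mul_right]
              refine tsum_congr fun i => ?_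
              simp only [hind]
              ring
    _ ≤ ∫⁻ z, ENNReal.ofReal (6 ^ ((n : ℝ) - α)) * ∑ τ : Fin n → Bool,
            ∑' i, volume (gridCube L (gridOrigin L τ) i) ^ (α / n - 1) *
              ((ind τ i z.1 * g z.1) * (ind τ i z.2 * φ z.2)) ∂(t.prod s) :=
        setLIntegral_le_lintegral _ _
    _ = ENNReal.ofReal (6 ^ ((n : ℝ) - α)) * ∑ τ : Fin n → Bool,
            ∑' i, ∫⁻ z, volume (gridCube L (gridOrigin L τ) i) ^ (α / n - 1) *
              ((ind τ i z.1 * g z.1) * (ind τ i z.2 * φ z.2)) ∂(t.prod s) := by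
        rw [lintegral_const_mul _ (Finset.measurable_sum _ fun τ _ =>
          Measurable.tsum fun i => hterm τ i),
          lintegral_finsetSum _ fun τ _ => Measurable.tsum fun i => hterm τ i]
        congr 1
        refine Finset.sum_congr rfl fun τ _ => ?_
        rw [lintegral_tsum fun i => (hterm τ i).aemeasurable]
    _ = _ := by
        congr 1
        refine Finset.sum_congr rfl fun τ _ => tsum_congr fun i => ?_
        have h1 := hindm τ i
        have dens : ∀ (μ : Measure (EuclideanSpace ℝ (Fin n))) (ψ : EuclideanSpace ℝ (Fin n) → ℝ≥0),
            ∫⁻ x, ind τ i x * ψ x ∂μ = μ.withDensity (fun x => ψ x)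
              (gridCube L (gridOrigin L τ) i) := fun μ ψ => by
          rw [withDensity_apply _ (hQ τ i), ← lintegral_indicator (hQ τ i)]
          refine lintegral_congr fun x => ?_
          by_cases hx : x ∈ gridCube L (gridOrigin L τ) i <;> simp [hind, hx]
        rw [lintegral_const_mul _ (by fun_prop),
          lintegral_prod_mul (f := fun x => ind τ i x * (g x : ℝ≥0∞))
            (g := fun x => ind τ i x * (φ x : ℝ≥0∞)) (by fun_prop) (by fun_prop), dens, dens]
        ring

/-- The constant depending on the dimension and the order of the fractional integral. -/
noncomputable def fracConst (n : ℕ) (α : ℝ) : ℝ≥0 :=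
  ((6 : ℝ) ^ ((n : ℝ) - α)).toNNReal * (2 ^ n * (4 * ((1 - (2 : ℝ) ^ (-α))⁻¹).toNNReal))

/-- The constant depending on the exponents and the lower bound of the entropy functions. -/
noncomputable def bumpFactor (p q c : ℝ) : ℝ≥0 :=
  entropyConst p c ^ (1 / p) * entropyConst q.conjExponent c ^ (1 / q.conjExponent)

theorem tsum_ofReal_div_rpow {L : ℝ} (hL : 0 < L) {α : ℝ} (hα : 0 < α) (j : ℕ) :
    ∑' k, ENNReal.ofReal ((L / 2 ^ (j + k)) ^ α) ≤
      ((1 - (2 : ℝ) ^ (-α))⁻¹).toNNReal * ENNReal.ofReal ((L / 2 ^ j) ^ α) := by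
  set r : ℝ := (2 : ℝ) ^ (-α) with hr
  have hr0 : 0 < r := by positivity
  have hr1 : r < 1 := Real.rpow_lt_one_of_one_lt_of_neg (by norm_num) (by linarith)
  have hterm : ∀ k : ℕ, (L / 2 ^ (j + k)) ^ α = (L / 2 ^ j) ^ α * r ^ k := by
    intro k
    have h2k : (0 : ℝ) < 2 ^ k := by positivity
    rw [show L / 2 ^ (j + k) = L / 2 ^ j * (2 ^ k)⁻¹ by rw [pow_add]; field_simp,
      Real.mul_rpow (by positivity) (by positivity)]
    congr 1
    rw [hr, Real.inv_rpow h2k.le, ← Real.rpow_neg h2k.le, ← Real.rpow_natCast,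
      ← Real.rpow_mul (by norm_num), ← Real.rpow_natCast, ← Real.rpow_mul (by norm_num), mul_comm]
  simp only [hterm]
  rw [← ENNReal.ofReal_tsum_of_nonneg (fun k => by positivity)
    ((summable_geometric_of_lt_one hr0.le hr1).mul_left _), tsum_mul_left,
    tsum_geometric_of_lt_one hr0.le hr1, ENNReal.ofReal_mul (by positivity), mul_comm]
  rfl

/-- The bilinear estimate for the fractional integral of non-negative functions. -/
theorem lintegral_fracWeight_mul_le {α p p' q q' c : ℝ} (hα : 0 < α) (hαn : α < n)
    (hpp : p.HolderConjugate p') (hqq : q.HolderConjugate q') (hpq : p ≤ q) (hc : 0 < c)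
    {ε₁ ε₂ : ℝ → ℝ} (hε₁ : IsEntropyFunction p c ε₁)
    (hε₂ : IsEntropyFunction q' c ε₂) {σ w : EuclideanSpace ℝ (Fin n) → ℝ} (hσ : IsWeight σ)
    (hw : IsWeight w) (hB : bumpConstant α p p' q q' ε₁ ε₂ σ w ≠ ∞)
    {φ g : EuclideanSpace ℝ (Fin n) → ℝ≥0} (hφ : Measurable φ) (hg : Measurable g)
    (hφp : ∫⁻ x, (φ x : ℝ≥0∞) ^ p ∂(weightMeasure σ) ≠ ∞)
    (hgq : ∫⁻ x, (g x : ℝ≥0∞) ^ q' ∂(weightMeasure w) ≠ ∞) :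
    ∫⁻ x, (∫⁻ y, fracWeight α x y * φ y ∂(weightMeasure σ)) * g x ∂(weightMeasure w) ≤
      bumpFactor p q c * fracConst n α * bumpConstant α p p' q q' ε₁ ε₂ σ w *
        (∫⁻ x, (φ x : ℝ≥0∞) ^ p ∂(weightMeasure σ)) ^ (1 / p) *
        (∫⁻ x, (g x : ℝ≥0∞) ^ q' ∂(weightMeasure w)) ^ (1 / q') := by
  have hn : n ≠ 0 := by
    rintro rfl
    simp only [Nat.cast_zero] at hαn
    linarith
  have hn' : (n : ℝ) ≠ 0 := by exact_mod_cast hn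
  have hp0 := hpp.pos
  have hq0' := hqq.symm.pos
  have hfw := measurable_fracWeight (n := n) α
  set B := bumpConstant α p p' q q' ε₁ ε₂ σ w with hBdef
  set H : EuclideanSpace ℝ (Fin n) × EuclideanSpace ℝ (Fin n) → ℝ≥0∞ :=
    fun z => fracWeight α z.1 z.2 * (φ z.2 * g z.1) with hH
  have hHm : Measurable H := by
    simp only [hH]
    exact hfw.mul (by fun_prop)
  set R := bumpFactor p q c * fracConst n α * B *
        (∫⁻ x, (φ x : ℝ≥0∞) ^ p ∂(weightMeasure σ)) ^ (1 / p) *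
        (∫⁻ x, (g x : ℝ≥0∞) ^ q' ∂(weightMeasure w)) ^ (1 / q') with hR
  -- The bound R does not depend on the largest scale L, so the truncation to ‖y - x‖ ≤ L/3 can be
  -- removed at the end.
  have hL : ∀ L : ℝ, 0 < L →
      ∫⁻ z in {z : EuclideanSpace ℝ (Fin n) × EuclideanSpace ℝ (Fin n) | ‖z.2 - z.1‖ ≤ L / 3},
        H z ∂((weightMeasure w).prod (weightMeasure σ)) ≤ R := by
    intro L hL
    refine (setLIntegral_fracWeight_le hαn hn hL _ _ hφ hg).trans ?_
    have hτ : ∀ τ : Fin n → Bool, _ := fun τ =>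
      tsum_dyadic_form_le (isLaminar_gridCube hL (gridOrigin L τ))
        (fun i => ⟨_, L / 2 ^ i.1, by positivity, rfl⟩) (fun j => ENNReal.ofReal ((L / 2 ^ j) ^ α))
        (tsum_ofReal_div_rpow hL hα) (fun i => by
          rw [volume_gridCube_rpow hL, mul_div_cancel₀ _ hn'])
        hpp hqq hpq hc hε₁ hε₂ hσ hw hB hφ hg hφp hgq
    refine (mul_le_mul_right (Finset.sum_le_sum fun τ _ => hτ τ) _).trans (le_of_eq ?_)
    rw [Finset.sum_const, Finset.card_univ, nsmul_eq_mul, hR, bumpFactor, fracConst,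
      hqq.conjExponent_eq, ENNReal.mul_rpow_of_nonneg _ _ (one_div_nonneg.2 hp0.le),
      ENNReal.mul_rpow_of_nonneg _ _ (one_div_nonneg.2 hq0'.le)]
    simp only [Fintype.card_fun, Fintype.card_bool, Fintype.card_fin]
    push_cast
    rw [ENNReal.coe_rpow_of_nonneg _ (one_div_nonneg.2 hp0.le),
      ENNReal.coe_rpow_of_nonneg _ (one_div_nonneg.2 hq0'.le),
      ENNReal.ofReal]
    ring
  calc ∫⁻ x, (∫⁻ y, fracWeight α x y * φ y ∂(weightMeasure σ)) * g x ∂(weightMeasure w)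
      = ∫⁻ z, H z ∂((weightMeasure w).prod (weightMeasure σ)) := by
        rw [lintegral_prod _ hHm.aemeasurable]
        refine lintegral_congr fun x => ?_
        rw [← lintegral_mul_const _ (by
          exact (measurable_fracWeight_left α x).mul (by fun_prop))]
        simp only [hH, mul_assoc]
    -- Monotone exhaustion by the regions with L = m + 1, phrased as continuity from below of the
    -- measure with density H.
    _ = ((weightMeasure w).prod (weightMeasure σ)).withDensity H (⋃ m : ℕ,
          {z : EuclideanSpace ℝ (Fin n) × EuclideanSpace ℝ (Fin n) |
            ‖z.2 - z.1‖ ≤ ((m : ℝ) + 1) / 3}) := by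
        rw [← setLIntegral_univ, ← withDensity_apply _ MeasurableSet.univ]
        congr 1
        refine (eq_univ_of_forall fun z => mem_iUnion.2 ?_).symm
        obtain ⟨m, hm⟩ := exists_nat_ge (3 * ‖z.2 - z.1‖)
        refine ⟨m, ?_⟩
        change ‖z.2 - z.1‖ ≤ ((m : ℝ) + 1) / 3
        linarith
    _ = ⨆ m : ℕ, ((weightMeasure w).prod (weightMeasure σ)).withDensity H
          {z : EuclideanSpace ℝ (Fin n) × EuclideanSpace ℝ (Fin n) |
            ‖z.2 - z.1‖ ≤ ((m : ℝ) + 1) / 3} := by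
        refine Monotone.measure_iUnion fun a b hab z hz => ?_
        change ‖z.2 - z.1‖ ≤ ((b : ℝ) + 1) / 3
        have h1 : ‖z.2 - z.1‖ ≤ ((a : ℝ) + 1) / 3 := hz
        have h2 : (a : ℝ) ≤ b := by exact_mod_cast hab
        linarith
    _ ≤ R := by
        refine iSup_le fun m => ?_
        rw [withDensity_apply _ (measurableSet_le (by fun_prop) measurable_const)]
        exact hL (m + 1) (by positivity)

/-- The norm inequality for the fractional integral of non-negative functions. -/
theorem lintegral_fracWeight_rpow_le {α p p' q q' c : ℝ} (hα : 0 < α) (hαn : α < n)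
    (hpp : p.HolderConjugate p') (hqq : q.HolderConjugate q') (hpq : p ≤ q) (hc : 0 < c)
    {ε₁ ε₂ : ℝ → ℝ} (hε₁ : IsEntropyFunction p c ε₁)
    (hε₂ : IsEntropyFunction q' c ε₂) {σ w : EuclideanSpace ℝ (Fin n) → ℝ} (hσ : IsWeight σ)
    (hw : IsWeight w) (hB : bumpConstant α p p' q q' ε₁ ε₂ σ w ≠ ∞)
    {φ : EuclideanSpace ℝ (Fin n) → ℝ≥0} (hφ : Measurable φ)
    (hφp : ∫⁻ x, (φ x : ℝ≥0∞) ^ p ∂(weightMeasure σ) ≠ ∞) :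
    (∫⁻ x, (∫⁻ y, fracWeight α x y * φ y ∂(weightMeasure σ)) ^ q ∂(weightMeasure w)) ^ (1 / q) ≤
      bumpFactor p q c * fracConst n α * bumpConstant α p p' q q' ε₁ ε₂ σ w *
        (∫⁻ x, (φ x : ℝ≥0∞) ^ p ∂(weightMeasure σ)) ^ (1 / p) := by
  refine lintegral_rpow_le_of_forall_lintegral_mul_le _ hqq ?_ fun g hg hgq =>
    lintegral_fracWeight_mul_le hα hαn hpp hqq hpq hc hε₁ hε₂ hσ hw hB hφ hg hφp hgq
  exact Measurable.lintegral_prod_right' (f := fun z => fracWeight α z.1 z.2 * (φ z.2 : ℝ≥0∞))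
    ((measurable_fracWeight α).mul (by fun_prop))

end EntropyBump

/-! ### Complex-valued functions: measurability and absolute convergence -/

namespace EntropyBump

variable {n : ℕ}

theorem enorm_fracKernel (α : ℝ) (f : EuclideanSpace ℝ (Fin n) → ℂ)
    (x y : EuclideanSpace ℝ (Fin n)) : ‖fracKernel α f x y‖ₑ = fracWeight α x y * ‖f y‖ₑ := by
  rw [fracKernel, enorm_smul, fracWeight, Real.enorm_eq_ofReal (by positivity)]

/-- A function measurable for the weighted measure becomes measurable for Lebesgue measure after
multiplication by the weight. -/
theorem IsWeight.aestronglyMeasurable_smul {σ : EuclideanSpace ℝ (Fin n) → ℝ} (hσ : IsWeight σ)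
    {f : EuclideanSpace ℝ (Fin n) → ℂ} (hf : AEStronglyMeasurable f (weightMeasure σ)) :
    AEStronglyMeasurable (fun y => σ y • f y) volume := by
  have hm := hσ.aemeasurable
  have he : weightMeasure σ = volume.withDensity
      fun x => (((hm.mk σ x).toNNReal : ℝ≥0) : ℝ≥0∞) := by
    refine withDensity_congr_ae ?_
    filter_upwards [hm.ae_eq_mk] with x hx
    rw [hx]; rfl
  rw [he, aestronglyMeasurable_withDensity_iff hm.measurable_mk.real_toNNReal] at hf
  refine hf.congr ?_
  filter_upwards [hm.ae_eq_mk] with x hx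
  rw [← hx, Real.coe_toNNReal _ (hσ.nonneg x)]

theorem stronglyMeasurable_fracKernel {α : ℝ} {h : EuclideanSpace ℝ (Fin n) → ℂ}
    (hh : StronglyMeasurable h) :
    StronglyMeasurable fun z : EuclideanSpace ℝ (Fin n) × EuclideanSpace ℝ (Fin n) =>
      fracKernel α h z.1 z.2 := by
  have h1 : Measurable fun z : EuclideanSpace ℝ (Fin n) × EuclideanSpace ℝ (Fin n) =>
      (‖z.2 - z.1‖ ^ ((n : ℝ) - α))⁻¹ := by fun_prop
  exact h1.stronglyMeasurable.smul (hh.comp_measurable measurable_snd)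

theorem fracKernel_congr_ae {α : ℝ} {h h' : EuclideanSpace ℝ (Fin n) → ℂ} (hh : h =ᵐ[volume] h')
    (x : EuclideanSpace ℝ (Fin n)) : fracKernel α h x =ᵐ[volume] fracKernel α h' x := by
  filter_upwards [hh] with y hy
  simp only [fracKernel, hy]

theorem stronglyMeasurable_fracIntegral {α : ℝ} {h : EuclideanSpace ℝ (Fin n) → ℂ}
    (hh : AEStronglyMeasurable h volume) : StronglyMeasurable (fracIntegral α h) := by
  have e : fracIntegral α h = fun x => ∫ y, fracKernel α (hh.mk h) x y :=
    funext fun x => integral_congr_ae (fracKernel_congr_ae hh.ae_eq_mk x)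
  rw [e]
  exact (stronglyMeasurable_fracKernel hh.stronglyMeasurable_mk).integral_prod_right'

/-- The modulus of f is known only σ-almost everywhere, which is enough: both integrands vanish
where σ = 0. -/
theorem IsWeight.lintegral_enorm_fracKernel_smul {σ : EuclideanSpace ℝ (Fin n) → ℝ}
    (hσ : IsWeight σ) (α : ℝ) {f : EuclideanSpace ℝ (Fin n) → ℂ}
    {φ : EuclideanSpace ℝ (Fin n) → ℝ≥0} (hφ : Measurable φ)
    (hφf : ∀ᵐ x ∂(weightMeasure σ), ‖f x‖ₑ = φ x) (x : EuclideanSpace ℝ (Fin n)) :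
    ∫⁻ y, ‖fracKernel α (fun y => σ y • f y) x y‖ₑ =
      ∫⁻ y, fracWeight α x y * φ y ∂(weightMeasure σ) := by
  have hd : AEMeasurable (fun y => ENNReal.ofReal (σ y)) volume := hσ.aemeasurable.ennreal_ofReal
  have hkφ : Measurable fun y => fracWeight α x y * (φ y : ℝ≥0∞) :=
    (measurable_fracWeight_left α x).mul hφ.coe_nnreal_ennreal
  have h2 : ∀ᵐ y, ENNReal.ofReal (σ y) ≠ 0 → ‖f y‖ₑ = φ y :=
    (ae_withDensity_iff' hd).1 hφf
  rw [weightMeasure, lintegral_withDensity_eq_lintegral_mul₀ hd hkφ.aemeasurable]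
  refine lintegral_congr_ae ?_
  filter_upwards [h2] with y hy
  rw [enorm_fracKernel, enorm_smul, Real.enorm_eq_ofReal (hσ.nonneg y), Pi.mul_apply]
  by_cases h0 : ENNReal.ofReal (σ y) = 0
  · rw [h0, zero_mul, mul_zero, zero_mul]
  · rw [hy h0, mul_left_comm]

end EntropyBump

theorem theorem1p3 :
    ∃ (A : ℕ → ℝ → ℝ≥0) (K : ℝ → ℝ → ℝ → ℝ≥0),
      ∀ (n : ℕ) (α p p' q q' c : ℝ), 0 < α → α < n →
        p.HolderConjugate p' → q.HolderConjugate q' → p ≤ q → 0 < c →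
        ∀ (ε₁ ε₂ : ℝ → ℝ), IsEntropyFunction p c ε₁ → IsEntropyFunction q' c ε₂ →
        ∀ (σ w : EuclideanSpace ℝ (Fin n) → ℝ), IsWeight σ → IsWeight w →
          bumpConstant α p p' q q' ε₁ ε₂ σ w < ∞ →
          ∀ f : EuclideanSpace ℝ (Fin n) → ℂ,
            MemLp f (ENNReal.ofReal p) (weightMeasure σ) →
            (∀ᵐ x ∂(weightMeasure w), Integrable (fracKernel α (fun y => σ y • f y) x) volume) ∧
            MemLp (fracIntegral α (fun y => σ y • f y)) (ENNReal.ofReal q) (weightMeasure w) ∧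
            eLpNorm (fracIntegral α (fun y => σ y • f y)) (ENNReal.ofReal q) (weightMeasure w) ≤
              K p q c * A n α * bumpConstant α p p' q q' ε₁ ε₂ σ w *
                eLpNorm f (ENNReal.ofReal p) (weightMeasure σ) := by
  refine ⟨fracConst, bumpFactor, ?_⟩
  intro n α p p' q q' c hα hαn hpp hqq hpq hc ε₁ ε₂ hε₁ hε₂ σ w hσ hw hB f hf
  have hp0 := hpp.pos
  have hq0 := hqq.pos
  have norm_eq : ∀ (r : ℝ), 0 < r → ∀ (μ : Measure (EuclideanSpace ℝ (Fin n)))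
      (u : EuclideanSpace ℝ (Fin n) → ℂ),
      eLpNorm u (ENNReal.ofReal r) μ = (∫⁻ x, ‖u x‖ₑ ^ r ∂μ) ^ (1 / r) := by
    intro r hr μ u
    rw [eLpNorm_eq_lintegral_rpow_enorm_toReal (by simpa using hr) ENNReal.ofReal_ne_top,
      ENNReal.toReal_ofReal hr.le]
  set φ : EuclideanSpace ℝ (Fin n) → ℝ≥0 := fun x => ‖hf.1.mk f x‖₊ with hφdef
  have hφ : Measurable φ := hf.1.stronglyMeasurable_mk.measurable.nnnorm
  have hφf : ∀ᵐ x ∂(weightMeasure σ), ‖f x‖ₑ = φ x := by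
    filter_upwards [hf.1.ae_eq_mk] with x hx
    rw [hx]; rfl
  have hφnorm : (∫⁻ x, (φ x : ℝ≥0∞) ^ p ∂(weightMeasure σ)) ^ (1 / p) =
      eLpNorm f (ENNReal.ofReal p) (weightMeasure σ) := by
    rw [norm_eq p hp0]
    congr 1
    refine lintegral_congr_ae ?_
    filter_upwards [hφf] with x hx
    rw [hx]
  have hφp : ∫⁻ x, (φ x : ℝ≥0∞) ^ p ∂(weightMeasure σ) ≠ ∞ := by
    intro e
    rw [e, ENNReal.top_rpow_of_pos (by positivity)] at hφnorm
    exact hf.2.ne hφnorm.symm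
  have hmeas := hσ.aestronglyMeasurable_smul hf.1
  set T : EuclideanSpace ℝ (Fin n) → ℝ≥0∞ :=
    fun x => ∫⁻ y, fracWeight α x y * φ y ∂(weightMeasure σ) with hT
  have hTm : Measurable T :=
    Measurable.lintegral_prod_right' (f := fun z => fracWeight α z.1 z.2 * (φ z.2 : ℝ≥0∞))
      ((measurable_fracWeight α).mul (by fun_prop))
  have hTeq : ∀ x, ∫⁻ y, ‖fracKernel α (fun y => σ y • f y) x y‖ₑ = T x :=
    fun x => hσ.lintegral_enorm_fracKernel_smul α hφ hφf x
  have hmain := lintegral_fracWeight_rpow_le hα hαn hpp hqq hpq hc hε₁ hε₂ hσ hw hB.ne hφ hφp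
  rw [hφnorm] at hmain
  have hfinal : (∫⁻ x, T x ^ q ∂(weightMeasure w)) ^ (1 / q) < ∞ := by
    refine hmain.trans_lt (lt_top_iff_ne_top.2 ?_)
    exact ENNReal.mul_ne_top (ENNReal.mul_ne_top
      (ENNReal.mul_ne_top ENNReal.coe_ne_top ENNReal.coe_ne_top) hB.ne) hf.2.ne
  have hTq : ∫⁻ x, T x ^ q ∂(weightMeasure w) ≠ ∞ := by
    intro e
    rw [e, ENNReal.top_rpow_of_pos (by positivity)] at hfinal
    exact lt_irrefl _ hfinal
  have hbound : eLpNorm (fracIntegral α (fun y => σ y • f y)) (ENNReal.ofReal q)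
      (weightMeasure w) ≤ (∫⁻ x, T x ^ q ∂(weightMeasure w)) ^ (1 / q) := by
    rw [norm_eq q hq0]
    gcongr with x
    rw [← hTeq x]
    -- This holds for every x, since the integral is 0 by default where it does not converge
    -- absolutely.
    exact enorm_integral_le_lintegral_enorm _
  refine ⟨?_, ⟨(stronglyMeasurable_fracIntegral hmeas).aestronglyMeasurable,
    hbound.trans_lt hfinal⟩, hbound.trans hmain⟩
  -- Absolute convergence follows from the norm bound: T^q has finite w-integral, so T is finite
  -- w-almost everywhere.
  filter_upwards [ae_lt_top (hTm.pow_const q) hTq] with x hx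
  refine ⟨?_, ?_⟩
  · have h1 := (stronglyMeasurable_fracKernel (α := α) hmeas.stronglyMeasurable_mk).comp_measurable
      (measurable_prodMk_left (x := x))
    exact h1.aestronglyMeasurable.congr (fracKernel_congr_ae hmeas.ae_eq_mk x).symm
  · rw [hasFiniteIntegral_iff_enorm, hTeq x]
    by_contra hcon
    rw [not_lt_top_iff.1 hcon, ENNReal.top_rpow_of_pos hq0] at hx
    exact lt_irrefl _ hx
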